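/- Let $R$ be a commutative ring, let $\mathcal{C}$ be an $R$-linear symmetric monoidal category (unit $1$, symmetry $\sigma$) which is $\otimes$-cocomplete, i.e. has all small colimits, preserved by $\otimes$ in each variable, and let $k\ge 0$. For $x\in\mathcal{C}$ let $S^nx=(x^{\otimes n})_{S_n}$ be the coequalizer of the action of the symmetric group $S_n$ permuting the tensor factors, let $Sx=\bigsqcup_{n\ge 0}S^nx$ with the commutative monoid structure induced by $x^{\otimes m}\otimes x^{\otimes n}\cong x^{\otimes(m+n)}$ (the free commutative monoid on $x$), and let $S^{\le k}x=\bigsqcup_{n=0}^kS^nx$. A map $f:x\to a$ to a commutative monoid $a$ induces a canonical monoid map $Sx\to a$, given on $x^{\otimes n}$ by $f^{\otimes n}$ followed by multiplication; write $\mathrm{can}$ for the composite $S^{\le k}x\to Sx\to a$, and also for the inclusion $S^{\le k}x\to Sx$. For a commutative monoid $a$ and $m,n\ge 1$ let $T:\mathcal{C}(a^{\otimes m},a^{\otimes n})\to\mathcal{C}(a^{\otimes(m+1)},a^{\otimes n})$ send $f$ to the difference of "multiply the new first factor into the last input factor, then apply $f$" and "apply $f$ to the old factors, then multiply the new factor into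 the last output factor" (for $n=1$, in terms of elements, $T(f)(b,c_1,\dots,c_m)=f(c_1,\dots,c_{m-1},bc_m)-b\,f(c_1,\dots,c_m)$). Let $\mathrm{D}_k(a)=\{\Delta\in\mathcal{C}(a,a): T^{k+1}(\Delta)=0\}$ be the $R$-module of differential operators on $a$ of order $k$. **Ungraded version.** 1. If $x\to a$ is a map to a commutative monoid such that the canonical map $Sx\to a$ is epic in $\mathcal{C}$, then $\mathrm{can}^*:\mathrm{D}_k(a)\to\mathcal{C}(S^{\le k}x,a)$ is injective. 2. For every $x\in\mathcal{C}$, restriction $\mathrm{can}^*:\mathrm{D}_k(Sx)\to\mathcal{C}(S^{\le k}x,Sx)$ is an isomorphism of $R$-modules. **Graded version.** Suppose moreover that $\mathcal{C}$ has a parity structure: an object $\pi$ with $\sigma_{\pi,\pi}=-\mathrm{id}_{\pi\otimes\pi}$ and an isomorphism $\xi:\pi\otimes\pi\to 1$. Let $\underline{\mathcal{C}}(x,y)$ be the supermodule with even part $\mathcal{C}(x,y)$ and odd part $\mathcal{C}(\pi\otimes x,y)$; precomposition with a map $g:x\to x'$ of $\mathcal{C}$ is $g^*(f_0,f_1)=(f_0\circ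 g,\,f_1\circ(\mathrm{id}_\pi\otimes g))$. Extend $T$ to odd maps $f:\pi\otimes a^{\otimes m}\to a^{\otimes n}$ by the same formula, keeping $\pi$ as the first factor and moving it past the new factor by $\sigma$ in the second term, and let $\underline{\mathrm{D}}_k(a)\subset\underline{\mathcal{C}}(a,a)$ be the sub-supermodule of all $\Delta$ with $T^{k+1}(\Delta)=0$. 1. If $x\to a$ is a map to a commutative monoid such that the canonical map $Sx\to a$ is epic in $\mathcal{C}$, then it is also epic in $\underline{\mathcal{C}}$ (precomposition with it is injective on $\underline{\mathcal{C}}(a,z)$ for all $z$), and $\mathrm{can}^*:\underline{\mathrm{D}}_k(a)\to\underline{\mathcal{C}}(S^{\le k}x,a)$ is injective. 2. For every $x\in\mathcal{C}$, restriction $\mathrm{can}^*:\underline{\mathrm{D}}_k(Sx)\to\underline{\mathcal{C}}(S^{\le k}x,Sx)$ is an isomorphism of supermodules (an $R$-linear isomorphism preserving and reflecting parity). -/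

import Mathlib

open CategoryTheory MonoidalCategory Limits

universe w v u

/-- A symmetric monoidal category is `⊗`-cocomplete if it has all small colimits and
`⊗` preserves them in each variable. -/
class TensorCocomplete (C : Type u) [Category.{v} C] [MonoidalCategory C] : Prop where
  hasColimits : HasColimits C
  preservesLeft : ∀ X : C, PreservesColimits (tensorLeft X)
  preservesRight : ∀ X : C, PreservesColimits (tensorRight X)

attribute [instance] TensorCocomplete.hasColimits TensorCocomplete.preservesLeft
  TensorCocomplete.preservesRight

namespace SymDiff

set_option linter.unusedSectionVars false

section Powers

variable {C : Type u} [Category.{v} C] [MonoidalCategory C] [SymmetricCategory C]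

/-- The symmetry `X ⊗ Y ⊗ Z ≅ Y ⊗ X ⊗ Z` exchanging the first two factors. -/
def swapFirst (X Y Z : C) : X ⊗ (Y ⊗ Z) ⟶ Y ⊗ (X ⊗ Z) :=
  (α_ X Y Z).inv ≫ (β_ X Y).hom ▷ Z ≫ (α_ Y X Z).hom

/-- The tensor power `x^{⊗n}`, bracketed to the right. -/
@[reducible] def tpow (x : C) : ℕ → C
  | 0 => 𝟙_ C
  | n + 1 => x ⊗ tpow x n

/-- The map `x ⊗ x^{⊗n} ⟶ x^{⊗(n+1)}` that moves the factor in position `0` to position `i`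
and keeps the other factors in their order. -/
def insertAt (x : C) : (n : ℕ) → Fin (n + 1) → (x ⊗ tpow x n ⟶ x ⊗ tpow x n)
  | 0, _ => 𝟙 _
  | n + 1, i =>
      Fin.cases (motive := fun _ => (x ⊗ (x ⊗ tpow x n) ⟶ x ⊗ (x ⊗ tpow x n))) (𝟙 _)
        (fun j => swapFirst x x (tpow x n) ≫ x ◁ insertAt x n j) i

/-- The permutation of `Fin n` obtained from a permutation `s` of `Fin (n + 1)` by
forgetting `0` and its image: it satisfies `s j.succ = (s 0).succAbove (tailPerm s j)`. -/
def tailPerm {n : ℕ} (s : Equiv.Perm (Fin (n + 1))) : Equiv.Perm (Fin n) :=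
  (Equiv.Perm.decomposeFin (Fin.cycleRange (s 0) * s)).2

/-- The action of the symmetric group on `x^{⊗n}` by permuting the tensor factors: the factor
in position `j` is moved to position `s j`. -/
def permMap (x : C) : (n : ℕ) → Equiv.Perm (Fin n) → (tpow x n ⟶ tpow x n)
  | 0, _ => 𝟙 _
  | n + 1, s => x ◁ permMap x n (tailPerm s) ≫ insertAt x n (s 0)

theorem swapFirst_nat (X Y : C) {Z W : C} (f : Z ⟶ W) :
    X ◁ Y ◁ f ≫ swapFirst X Y W = swapFirst X Y Z ≫ Y ◁ X ◁ f := by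
  simp only [swapFirst, Category.assoc]
  rw [associator_inv_naturality_right_assoc, whisker_exchange_assoc,
    associator_naturality_right]

theorem swapFirst_tensor (X Y Z : C) :
    swapFirst (X ⊗ Y) X Z ≫ X ◁ (α_ X Y Z).hom ≫ swapFirst X X (Y ⊗ Z) =
      (α_ X Y (X ⊗ Z)).hom ≫ X ◁ swapFirst Y X Z := by
  have e : (β_ X X).hom ▷ Y ▷ Z ≫ (β_ X X).hom ▷ Y ▷ Z = 𝟙 _ := by
    simp only [← comp_whiskerRight, SymmetricCategory.symmetry, id_whiskerRight]
  simp only [swapFirst, BraidedCategory.braiding_tensor_left_hom]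
  calc _ = 𝟙 _ ⊗≫ X ◁ (β_ Y X).hom ▷ Z ⊗≫
        ((β_ X X).hom ▷ Y ▷ Z ≫ (β_ X X).hom ▷ Y ▷ Z) ⊗≫ 𝟙 _ := by monoidal
    _ = _ := by rw [e]; monoidal

theorem tailPerm_spec {n : ℕ} (s : Equiv.Perm (Fin (n + 1))) (j : Fin n) :
    s j.succ = (s 0).succAbove (tailPerm s j) := by
  have h0 : (Fin.cycleRange (s 0) * s) 0 = 0 := by simp
  obtain ⟨t, ht⟩ : ∃ t, Fin.cycleRange (s 0) * s = Equiv.Perm.decomposeFin.symm (0, t) := by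
    refine ⟨tailPerm s, ?_⟩
    rw [Equiv.eq_symm_apply]
    refine Prod.ext ?_ rfl
    obtain ⟨⟨p, t⟩, hp⟩ := Equiv.Perm.decomposeFin.symm.surjective (Fin.cycleRange (s 0) * s)
    rw [← hp] at h0 ⊢
    simpa using h0
  have h1 : tailPerm s = t := by simp [tailPerm, ht]
  have h2 : (Fin.cycleRange (s 0) * s) j.succ = (t j).succ := by rw [ht]; simp
  apply (Fin.cycleRange (s 0)).injective
  rw [h1, Fin.cycleRange_succAbove]
  exact h2

theorem exists_perm {n : ℕ} (i : Fin (n + 1)) (t : Equiv.Perm (Fin n)) :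
    ∃ s : Equiv.Perm (Fin (n + 1)), s 0 = i ∧ tailPerm s = t := by
  refine ⟨(Fin.cycleRange i)⁻¹ * Equiv.Perm.decomposeFin.symm (0, t), ?_, ?_⟩
  · simp
  · simp [tailPerm]

theorem insertAt_zero (x : C) (n : ℕ) : insertAt x n 0 = 𝟙 _ := by
  cases n <;> rfl

theorem permMap_one (x : C) (n : ℕ) : permMap x n 1 = 𝟙 _ := by
  induction n with
  | zero => rfl
  | succ n ih =>
    have : tailPerm (1 : Equiv.Perm (Fin (n + 1))) = 1 := by
      refine Equiv.ext fun j => ?_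
      have := tailPerm_spec (1 : Equiv.Perm (Fin (n + 1))) j
      simpa using this.symm
    simp only [permMap, this, ih, Equiv.Perm.coe_one, id_eq, insertAt_zero]
    simp [tpow]

/-- The iterated action `x^{⊗n} ⊗ W ⟶ Z` of a map `x ⊗ Z ⟶ Z`, starting with `e : W ⟶ Z`. -/
def iter {x Z : C} (act : x ⊗ Z ⟶ Z) {W : C} (e : W ⟶ Z) : (n : ℕ) → (tpow x n ⊗ W ⟶ Z)
  | 0 => (λ_ W).hom ≫ e
  | n + 1 => (α_ x (tpow x n) W).hom ≫ x ◁ iter act e n ≫ act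

/-- One step of `iter`. -/
def step {x Z : C} (act : x ⊗ Z ⟶ Z) {W T : C} (m : T ⊗ W ⟶ Z) : (x ⊗ T) ⊗ W ⟶ Z :=
  (α_ x T W).hom ≫ x ◁ m ≫ act

theorem step_whisker {x Z : C} (act : x ⊗ Z ⟶ Z) {W T T' : C} (g : T ⟶ T') (m : T' ⊗ W ⟶ Z) :
    (x ◁ g) ▷ W ≫ step act m = step act (g ▷ W ≫ m) := by
  simp [step]

theorem step_swap {x Z : C} {act : x ⊗ Z ⟶ Z}
    (h : swapFirst x x Z ≫ x ◁ act ≫ act = x ◁ act ≫ act) {W T : C} (m : T ⊗ W ⟶ Z) :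
    swapFirst x x T ▷ W ≫ step act (step act m) = step act (step act m) := by
  have e1 : step act (step act m) =
      (α_ x (x ⊗ T) W).hom ≫ x ◁ (α_ x T W).hom ≫ x ◁ x ◁ m ≫ x ◁ act ≫ act := by
    simp [step]
  have e2 : swapFirst x x T ▷ W ≫ (α_ x (x ⊗ T) W).hom ≫ x ◁ (α_ x T W).hom =
      (α_ x (x ⊗ T) W).hom ≫ x ◁ (α_ x T W).hom ≫ swapFirst x x (T ⊗ W) := by
    simp only [swapFirst]
    monoidal
  rw [e1, reassoc_of% e2, ← reassoc_of% swapFirst_nat, h]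

theorem insertAt_iter {x Z : C} {act : x ⊗ Z ⟶ Z}
    (h : swapFirst x x Z ≫ x ◁ act ≫ act = x ◁ act ≫ act) {W : C} (e : W ⟶ Z) (n : ℕ)
    (i : Fin (n + 1)) : insertAt x n i ▷ W ≫ step act (iter act e n) = step act (iter act e n) := by
  induction n with
  | zero => simp [insertAt]
  | succ n ih =>
    induction i using Fin.cases with
    | zero => simp [insertAt_zero]
    | succ j =>
      have := ih j
      change (swapFirst x x (tpow x n) ≫ x ◁ insertAt x n j) ▷ W ≫
        step act (step act (iter act e n)) = step act (step act (iter act e n))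
      rw [comp_whiskerRight, Category.assoc, step_whisker, this, step_swap h]

theorem permMap_iter {x Z : C} {act : x ⊗ Z ⟶ Z}
    (h : swapFirst x x Z ≫ x ◁ act ≫ act = x ◁ act ≫ act) {W : C} (e : W ⟶ Z) (n : ℕ)
    (s : Equiv.Perm (Fin n)) : permMap x n s ▷ W ≫ iter act e n = iter act e n := by
  induction n with
  | zero => simp [permMap]
  | succ n ih =>
    change (x ◁ permMap x n (tailPerm s) ≫ insertAt x n (s 0)) ▷ W ≫ step act (iter act e n) =
      step act (iter act e n)
    rw [comp_whiskerRight, Category.assoc, insertAt_iter h, step_whisker, ih]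

theorem exists_permMap_whisker (x : C) {n : ℕ} (t : Equiv.Perm (Fin n)) :
    ∃ s : Equiv.Perm (Fin (n + 1)), permMap x (n + 1) s = x ◁ permMap x n t := by
  obtain ⟨s, h0, h1⟩ := exists_perm 0 t
  refine ⟨s, ?_⟩
  simp only [permMap, h0, h1, insertAt_zero]
  exact Category.comp_id _

theorem exists_permMap_swap (x : C) (n : ℕ) :
    ∃ s : Equiv.Perm (Fin (n + 2)), permMap x (n + 2) s = swapFirst x x (tpow x n) := by
  obtain ⟨s, h0, h1⟩ := exists_perm (n := n + 1) 1 1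
  refine ⟨s, ?_⟩
  simp only [permMap, h0, h1]
  have : insertAt x (n + 1) 1 = swapFirst x x (tpow x n) := by
    change swapFirst x x (tpow x n) ≫ x ◁ insertAt x n 0 = _
    rw [insertAt_zero]
    simp
  rw [this]
  have h2 := permMap_one x (n + 1)
  simp only [permMap] at h2
  rw [h2]
  exact (congrArg (· ≫ swapFirst x x (tpow x n)) (whiskerLeft_id x (x ⊗ tpow x n))).trans
    (Category.id_comp _)

end Powers

section Free

variable {C : Type u} [Category.{v} C] [MonoidalCategory C] [SymmetricCategory C]
  [TensorCocomplete C]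

/-- The symmetric power `S^n x`: the coequalizer of the action of the symmetric group on
`x^{⊗n}`. -/
noncomputable def symPow (x : C) (n : ℕ) : C := wideCoequalizer (permMap x n)

/-- The object `Sx`, the coproduct of all `S^n x`. -/
noncomputable def Sym (x : C) : C := ∐ fun n : ℕ => symPow x n

/-- The object `S^{≤ k} x`, the coproduct of the `S^n x` with `n ≤ k`. -/
noncomputable def symLE (x : C) (k : ℕ) : C := ∐ fun n : Fin (k + 1) => symPow x n

/-- The inclusion `S^n x ⟶ Sx`. -/
noncomputable def symIncl (x : C) (n : ℕ) : symPow x n ⟶ Sym x :=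
  Sigma.ι (fun n : ℕ => symPow x n) n

/-- The canonical map `S^{≤ k} x ⟶ Sx`. -/
noncomputable def symLEIncl (x : C) (k : ℕ) : symLE x k ⟶ Sym x :=
  Sigma.desc fun n : Fin (k + 1) => symIncl x n

/-- The projection `x^{⊗n} ⟶ S^n x`. -/
noncomputable def symProj (x : C) (n : ℕ) : tpow x n ⟶ symPow x n :=
  wideCoequalizer.π (permMap x n)

/-- The composite `x^{⊗n} ⟶ S^n x ⟶ Sx`. -/
noncomputable def toSym (x : C) (n : ℕ) : tpow x n ⟶ Sym x := symProj x n ≫ symIncl x n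

theorem permMap_toSym (x : C) (n : ℕ) (s : Equiv.Perm (Fin n)) :
    permMap x n s ≫ toSym x n = toSym x n := by
  have h : permMap x n s ≫ symProj x n = permMap x n 1 ≫ symProj x n :=
    wideCoequalizer.condition _ _ _
  rw [toSym, reassoc_of% h, permMap_one, Category.id_comp]

section Desc

variable {D : Type u} [Category.{v} D] (F : C ⥤ D) [PreservesColimits F]

theorem toSym_hom_ext {x : C} {Y : D} {f g : F.obj (Sym x) ⟶ Y}
    (h : ∀ n, F.map (toSym x n) ≫ f = F.map (toSym x n) ≫ g) : f = g := by
  have : PreservesColimitsOfSize.{0, 0} F := preservesSmallestColimits_of_preservesColimits F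
  have hc := isColimitOfPreserves F (colimit.isColimit (Discrete.functor fun n : ℕ => symPow x n))
  refine hc.hom_ext fun ⟨n⟩ => ?_
  have hn := isColimitOfPreserves F
    (colimit.isColimit (parallelFamily (permMap x n)))
  have key : ∀ f g : F.obj (symPow x n) ⟶ Y,
      F.map (symProj x n) ≫ f = F.map (symProj x n) ≫ g → f = g := by
    intro f g hfg
    refine hn.hom_ext fun j => ?_
    cases j with
    | one => exact hfg
    | zero =>
      have e : (F.mapCocone (colimit.cocone (parallelFamily (permMap x n)))).ι.app .zero =
          F.map (permMap x n 1) ≫ F.map (symProj x n) :=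
        ((F.mapCocone (colimit.cocone (parallelFamily (permMap x n)))).w
          (WalkingParallelFamily.Hom.line (1 : Equiv.Perm (Fin n)))).symm
      refine (congrArg (· ≫ f) e).trans (Eq.trans ?_ (congrArg (· ≫ g) e).symm)
      exact (Category.assoc _ _ _).trans
        ((congrArg (F.map (permMap x n 1) ≫ ·) hfg).trans (Category.assoc _ _ _).symm)
  refine key _ _ ?_
  have := h n
  rw [toSym, F.map_comp, Category.assoc, Category.assoc] at this
  exact this

theorem exists_desc {x : C} {Y : D} (g : ∀ n, F.obj (tpow x n) ⟶ Y)
    (hg : ∀ n s, F.map (permMap x n s) ≫ g n = g n) :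
    ∃ f : F.obj (Sym x) ⟶ Y, ∀ n, F.map (toSym x n) ≫ f = g n := by
  have : PreservesColimitsOfSize.{0, 0} F := preservesSmallestColimits_of_preservesColimits F
  have h1 : ∀ n, ∃ f : F.obj (symPow x n) ⟶ Y, F.map (symProj x n) ≫ f = g n := by
    intro n
    have hn := isColimitOfPreserves F
      (colimit.isColimit (parallelFamily (permMap x n)))
    let c : Cocone (parallelFamily (permMap x n) ⋙ F) :=
      { pt := Y
        ι :=
          { app := fun j => match j with
              | .zero => g n
              | .one => g n
            naturality := by
              rintro _ _ (_ | s)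
              · simp
              · simpa using hg n s } }
    exact ⟨hn.desc c, hn.fac c .one⟩
  choose f hf using h1
  have hc := isColimitOfPreserves F (colimit.isColimit (Discrete.functor fun n : ℕ => symPow x n))
  let c : Cocone (Discrete.functor (fun n : ℕ => symPow x n) ⋙ F) :=
    { pt := Y
      ι := Discrete.natTrans fun j => f j.as }
  obtain ⟨d, hd⟩ : ∃ d : F.obj (Sym x) ⟶ Y, ∀ n, F.map (symIncl x n) ≫ d = f n :=
    ⟨hc.desc c, fun n => hc.fac c ⟨n⟩⟩
  refine ⟨d, fun n => ?_⟩
  rw [toSym, F.map_comp, Category.assoc, hd, hf]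

end Desc

theorem exists_cons (x : C) :
    ∃ f : x ⊗ Sym x ⟶ Sym x, ∀ n, x ◁ toSym x n ≫ f = toSym x (n + 1) :=
  exists_desc (tensorLeft x) (fun n => toSym x (n + 1)) fun n t => by
    obtain ⟨s, hs⟩ := exists_permMap_whisker x t
    have := permMap_toSym x (n + 1) s
    rw [hs] at this
    exact this

/-- Multiplication by the generators, `x ⊗ Sx ⟶ Sx`, induced by the projections
`x ⊗ x^{⊗n} ⟶ S^{n+1} x`. -/
noncomputable def symCons (x : C) : x ⊗ Sym x ⟶ Sym x := (exists_cons x).choose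

theorem symCons_spec (x : C) (n : ℕ) : x ◁ toSym x n ≫ symCons x = toSym x (n + 1) :=
  (exists_cons x).choose_spec n

theorem symCons_swap (x : C) :
    swapFirst x x (Sym x) ≫ x ◁ symCons x ≫ symCons x = x ◁ symCons x ≫ symCons x := by
  refine toSym_hom_ext (tensorLeft x ⋙ tensorLeft x) fun n => ?_
  change x ◁ x ◁ toSym x n ≫ _ = x ◁ x ◁ toSym x n ≫ _
  have e : x ◁ x ◁ toSym x n ≫ x ◁ symCons x ≫ symCons x = toSym x (n + 2) := by
    rw [← whiskerLeft_comp_assoc, symCons_spec, symCons_spec]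
  obtain ⟨s, hs⟩ := exists_permMap_swap x n
  have h := permMap_toSym x (n + 2) s
  rw [hs] at h
  rw [reassoc_of% swapFirst_nat, e, h]

theorem exists_mul (x : C) :
    ∃ f : Sym x ⊗ Sym x ⟶ Sym x, ∀ n, toSym x n ▷ Sym x ≫ f = iter (symCons x) (𝟙 _) n :=
  exists_desc (tensorRight (Sym x)) (fun n => iter (symCons x) (𝟙 _) n)
    fun n s => permMap_iter (symCons_swap x) _ n s

/-- The multiplication of `Sx`; see `toSym_symMul`. -/
noncomputable def symMul (x : C) : Sym x ⊗ Sym x ⟶ Sym x := (exists_mul x).choose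

theorem symMul_spec (x : C) (n : ℕ) :
    toSym x n ▷ Sym x ≫ symMul x = iter (symCons x) (𝟙 _) n :=
  (exists_mul x).choose_spec n

/-- The unit of `Sx`, namely `1 ≅ S^0 x ⟶ Sx`. -/
noncomputable def symOne (x : C) : 𝟙_ C ⟶ Sym x := toSym x 0

/-- The concatenation isomorphism `x^{⊗m} ⊗ x^{⊗n} ⟶ x^{⊗(m+n)}`. -/
def concat (x : C) : (m n : ℕ) → (tpow x m ⊗ tpow x n ⟶ tpow x (n + m))
  | 0, n => (λ_ (tpow x n)).hom
  | m + 1, n => (α_ x (tpow x m) (tpow x n)).hom ≫ x ◁ concat x m n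

/-- The multiplication of `Sx` is induced by `x^{⊗m} ⊗ x^{⊗n} ≅ x^{⊗(m+n)} ⟶ S^{m+n} x`. -/
theorem toSym_symMul (x : C) (m n : ℕ) :
    (toSym x m ⊗ₘ toSym x n) ≫ symMul x = concat x m n ≫ toSym x (n + m) := by
  rw [tensorHom_def', Category.assoc, symMul_spec]
  induction m with
  | zero => simp [iter, concat, tpow]
  | succ m ih =>
    change (x ⊗ tpow x m) ◁ toSym x n ≫ (α_ x (tpow x m) (Sym x)).hom ≫
      x ◁ iter (symCons x) (𝟙 _) m ≫ symCons x =
      ((α_ x (tpow x m) (tpow x n)).hom ≫ x ◁ concat x m n) ≫ toSym x (n + m + 1)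
    rw [associator_naturality_right_assoc, ← whiskerLeft_comp_assoc, ih, whiskerLeft_comp_assoc,
      symCons_spec, Category.assoc]

theorem symOne_symMul (x : C) : symOne x ▷ Sym x ≫ symMul x = (λ_ (Sym x)).hom := by
  have := symMul_spec x 0
  rw [iter, Category.comp_id] at this
  exact this

theorem sym_hom_ind {x W Z : C} (act : x ⊗ Z ⟶ Z) {f g : Sym x ⊗ W ⟶ Z}
    (h0 : symOne x ▷ W ≫ f = symOne x ▷ W ≫ g)
    (hf : symCons x ▷ W ≫ f = (α_ x (Sym x) W).hom ≫ x ◁ f ≫ act)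
    (hg : symCons x ▷ W ≫ g = (α_ x (Sym x) W).hom ≫ x ◁ g ≫ act) : f = g := by
  refine toSym_hom_ext (tensorRight W) fun n => ?_
  change toSym x n ▷ W ≫ f = toSym x n ▷ W ≫ g
  induction n with
  | zero => exact h0
  | succ n ih =>
    rw [← symCons_spec, comp_whiskerRight, Category.assoc, Category.assoc, hf, hg,
      associator_naturality_middle_assoc, associator_naturality_middle_assoc,
      ← whiskerLeft_comp_assoc, ← whiskerLeft_comp_assoc, ih]

theorem symCons_symMul (x : C) :
    symCons x ▷ Sym x ≫ symMul x = (α_ x (Sym x) (Sym x)).hom ≫ x ◁ symMul x ≫ symCons x := by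
  refine toSym_hom_ext (tensorLeft x ⋙ tensorRight (Sym x)) fun n => ?_
  change (x ◁ toSym x n) ▷ Sym x ≫ _ = (x ◁ toSym x n) ▷ Sym x ≫ _
  rw [← comp_whiskerRight_assoc, symCons_spec, symMul_spec, associator_naturality_middle_assoc,
    ← whiskerLeft_comp_assoc, symMul_spec]
  rfl

theorem sym_mul_one (x : C) : Sym x ◁ symOne x ≫ symMul x = (ρ_ (Sym x)).hom := by
  refine sym_hom_ind (symCons x) ?_ ?_ ?_
  · rw [← whisker_exchange_assoc, symOne_symMul]
    simp [unitors_equal]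
  · rw [← whisker_exchange_assoc, symCons_symMul]
    simp
  · simp

theorem sym_mul_assoc (x : C) :
    symMul x ▷ Sym x ≫ symMul x =
      (α_ (Sym x) (Sym x) (Sym x)).hom ≫ Sym x ◁ symMul x ≫ symMul x := by
  rw [← Iso.inv_comp_eq]
  refine sym_hom_ind (symCons x) ?_ ?_ ?_
  · rw [associator_inv_naturality_left_assoc, ← comp_whiskerRight_assoc, symOne_symMul,
      ← whisker_exchange_assoc, symOne_symMul]
    simp
  · rw [associator_inv_naturality_left_assoc, ← comp_whiskerRight_assoc, symCons_symMul]
    simp [symCons_symMul]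
  · rw [← whisker_exchange_assoc, symCons_symMul]
    simp

theorem sym_mul_cons (x : C) :
    Sym x ◁ symCons x ≫ symMul x =
      swapFirst (Sym x) x (Sym x) ≫ x ◁ symMul x ≫ symCons x := by
  have nat : ∀ {A B : C} (f : A ⟶ B), f ▷ (x ⊗ Sym x) ≫ swapFirst B x (Sym x) =
      swapFirst A x (Sym x) ≫ x ◁ f ▷ Sym x := by
    intro A B f
    simp only [swapFirst, Category.assoc]
    rw [associator_inv_naturality_left_assoc, ← comp_whiskerRight_assoc,
      BraidedCategory.braiding_naturality_left, comp_whiskerRight_assoc,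
      associator_naturality_middle]
  refine sym_hom_ind (symCons x) ?_ ?_ ?_
  · rw [← whisker_exchange_assoc, symOne_symMul, reassoc_of% nat, ← whiskerLeft_comp_assoc,
      symOne_symMul]
    simp [swapFirst]
  · rw [← whisker_exchange_assoc, symCons_symMul]
    simp
  · rw [reassoc_of% nat, ← whiskerLeft_comp_assoc, symCons_symMul]
    simp only [whiskerLeft_comp, Category.assoc]
    conv_lhs => rw [← symCons_swap, reassoc_of% swapFirst_nat, reassoc_of% swapFirst_tensor]

theorem sym_mul_comm (x : C) : (β_ (Sym x) (Sym x)).hom ≫ symMul x = symMul x := by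
  refine sym_hom_ind (symCons x) ?_ ?_ ?_
  · rw [BraidedCategory.braiding_naturality_left_assoc, sym_mul_one, symOne_symMul]
    simp
  · rw [BraidedCategory.braiding_naturality_left_assoc, sym_mul_cons]
    have e : (β_ x (Sym x)).hom ▷ Sym x ≫ (β_ (Sym x) x).hom ▷ Sym x = 𝟙 _ := by
      rw [← comp_whiskerRight, SymmetricCategory.symmetry, id_whiskerRight]
    simp [swapFirst, reassoc_of% e]
  · exact symCons_symMul x

noncomputable instance (x : C) : MonObj (Sym x) where
  one := symOne x
  mul := symMul x
  one_mul := symOne_symMul x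
  mul_one := sym_mul_one x
  mul_assoc := sym_mul_assoc x

instance (x : C) : IsCommMonObj (Sym x) where
  mul_comm := sym_mul_comm x


/-- The map `x^{⊗n} ⟶ a^{⊗n} ⟶ a` given by `f^{⊗n}` followed by the `n`-fold
multiplication of `a`. -/
def mulPow {x a : C} [MonObj a] (f : x ⟶ a) : (n : ℕ) → (tpow x n ⟶ a)
  | 0 => MonObj.one
  | n + 1 => (f ⊗ₘ mulPow f n) ≫ MonObj.mul

theorem mulPow_eq {x a : C} [MonObj a] (f : x ⟶ a) (n : ℕ) :
    mulPow f n = (ρ_ (tpow x n)).inv ≫ iter (f ▷ a ≫ MonObj.mul) MonObj.one n := by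
  induction n with
  | zero => simp [mulPow, iter, unitors_equal]
  | succ n ih =>
    rw [mulPow, tensorHom_def', ih, iter]
    simp

theorem act_swap {x a : C} [MonObj a] [IsCommMonObj a] (f : x ⟶ a) :
    swapFirst x x a ≫ x ◁ (f ▷ a ≫ MonObj.mul) ≫ f ▷ a ≫ MonObj.mul =
      x ◁ (f ▷ a ≫ MonObj.mul) ≫ f ▷ a ≫ MonObj.mul := by
  have e : x ◁ (f ▷ a ≫ MonObj.mul) ≫ f ▷ a ≫ MonObj.mul =
      (α_ x x a).inv ≫ ((f ⊗ₘ f) ≫ MonObj.mul) ▷ a ≫ MonObj.mul := by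
    simp only [whiskerLeft_comp, Category.assoc, comp_whiskerRight, MonObj.mul_assoc]
    rw [whisker_exchange_assoc, tensorHom_def']
    simp
  have c : (β_ x x).hom ≫ (f ⊗ₘ f) ≫ MonObj.mul = (f ⊗ₘ f) ≫ MonObj.mul := by
    rw [← BraidedCategory.braiding_naturality_assoc, IsCommMonObj.mul_comm]
  rw [e, swapFirst]
  simp only [Category.assoc, Iso.hom_inv_id_assoc]
  rw [← comp_whiskerRight_assoc, c]

theorem exists_lift {x a : C} [MonObj a] [IsCommMonObj a] (f : x ⟶ a) :
    ∃ g : Sym x ⟶ a, ∀ n, toSym x n ≫ g = mulPow f n :=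
  exists_desc (𝟭 C) (fun n => mulPow f n) fun n s => by
    have h := permMap_iter (act_swap f) (MonObj.one (X := a)) n s
    change permMap x n s ≫ mulPow f n = mulPow f n
    rw [mulPow_eq, rightUnitor_inv_naturality_assoc, h]

/-- The canonical map of monoids `Sx ⟶ a` extending a map `f : x ⟶ a` to a commutative monoid;
on `x^{⊗n}` it is `f^{⊗n}` followed by multiplication. -/
noncomputable def lift {x a : C} [MonObj a] [IsCommMonObj a] (f : x ⟶ a) : Sym x ⟶ a :=
  (exists_lift f).choose

theorem toSym_lift {x a : C} [MonObj a] [IsCommMonObj a] (f : x ⟶ a) (n : ℕ) :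
    toSym x n ≫ lift f = mulPow f n :=
  (exists_lift f).choose_spec n

/-- The structural map `x ≅ S^1 x ⟶ Sx`. -/
noncomputable def symGen (x : C) : x ⟶ Sym x := (ρ_ x).inv ≫ toSym x 1

theorem symGen_lift {x a : C} [MonObj a] [IsCommMonObj a] (f : x ⟶ a) :
    symGen x ≫ lift f = f := by
  rw [symGen, Category.assoc, toSym_lift]
  simp [mulPow, MonoidalCategory.tensorHom_def]

theorem symCons_lift {x a : C} [MonObj a] [IsCommMonObj a] (f : x ⟶ a) :
    symCons x ≫ lift f = (f ⊗ₘ lift f) ≫ MonObj.mul := by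
  refine toSym_hom_ext (tensorLeft x) fun n => ?_
  change x ◁ toSym x n ≫ _ = x ◁ toSym x n ≫ _
  rw [reassoc_of% symCons_spec, toSym_lift, mulPow, ← toSym_lift]
  simp [tensorHom_def']

instance {x a : C} [MonObj a] [IsCommMonObj a] (f : x ⟶ a) : IsMonHom (lift f) where
  one_hom := toSym_lift f 0
  mul_hom := by
    change symMul x ≫ lift f = _
    refine sym_hom_ind (f ▷ a ≫ MonObj.mul) ?_ ?_ ?_
    · have h : symOne x ≫ lift f = MonObj.one := toSym_lift f 0
      rw [reassoc_of% symOne_symMul, MonoidalCategory.tensorHom_def, Category.assoc,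
        ← comp_whiskerRight_assoc, h, ← whisker_exchange_assoc, MonObj.one_mul]
      simp
    · rw [reassoc_of% symCons_symMul, symCons_lift, tensorHom_def']
      simp
    · rw [MonoidalCategory.tensorHom_def, Category.assoc, ← comp_whiskerRight_assoc, symCons_lift,
        MonoidalCategory.tensorHom_def' f]
      simp only [comp_whiskerRight, whiskerLeft_comp, Category.assoc]
      rw [← whisker_exchange_assoc, MonObj.mul_assoc, whisker_exchange_assoc]
      simp only [whiskerRight_tensor, Category.assoc, tensor_whiskerLeft, Iso.inv_hom_id_assoc]
      rw [associator_naturality_left_assoc, associator_naturality_left_assoc]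
      simp only [Iso.inv_hom_id_assoc]
      rw [← whisker_exchange_assoc, associator_naturality_middle_assoc]

theorem symGen_mul (x : C) : symGen x ▷ Sym x ≫ symMul x = symCons x := by
  rw [symGen, comp_whiskerRight_assoc, symMul_spec]
  simp [iter]

/-- `Sx` is the free commutative monoid on `x`. -/
theorem lift_unique {x a : C} [MonObj a] [IsCommMonObj a] (f : x ⟶ a) (g : Sym x ⟶ a)
    [IsMonHom g] (h : symGen x ≫ g = f) : g = lift f := by
  refine toSym_hom_ext (𝟭 C) fun n => ?_
  change toSym x n ≫ g = toSym x n ≫ lift f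
  have hm : symMul x ≫ g = (g ⊗ₘ g) ≫ MonObj.mul := IsMonHom.mul_hom (f := g)
  have hc : symCons x ≫ g = (f ⊗ₘ g) ≫ MonObj.mul := by
    rw [← symGen_mul, Category.assoc, hm, ← h]
    simp [MonoidalCategory.tensorHom_def]
  induction n with
  | zero => exact (IsMonHom.one_hom (f := g)).trans (toSym_lift f 0).symm
  | succ n ih =>
    rw [← symCons_spec, Category.assoc, Category.assoc, hc, symCons_lift,
      MonoidalCategory.tensorHom_def', MonoidalCategory.tensorHom_def', Category.assoc,
      Category.assoc, ← whiskerLeft_comp_assoc, ih, whiskerLeft_comp_assoc]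

end Free

section DiffOps

variable (R : Type w) [CommRing R] {C : Type u} [Category.{v} C] [Preadditive C] [Linear R C]
  [MonoidalCategory C] [SymmetricCategory C] [MonoidalPreadditive C] [MonoidalLinear R C]

/-- The tensor power `a^{⊗(m+1)}`, bracketed to the right, for `m ≥ 0`. -/
@[reducible] def tpowSucc (a : C) : ℕ → C
  | 0 => a
  | m + 1 => a ⊗ tpowSucc a m

/-- The map `a ⊗ a^{⊗(m+1)} ⟶ a^{⊗(m+1)}` multiplying the first strand into the last one:
`b ⊗ c₁ ⊗ ⋯ ⊗ cₘ ⊗ c ↦ c₁ ⊗ ⋯ ⊗ cₘ ⊗ b c`. -/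
def mulLast (a : C) [MonObj a] : (m : ℕ) → (a ⊗ tpowSucc a m ⟶ tpowSucc a m)
  | 0 => MonObj.mul
  | m + 1 => swapFirst a a (tpowSucc a m) ≫ a ◁ mulLast a m

/-- The map `T : C(a^{⊗(m+1)}, a^{⊗(n+1)}) ⟶ C(a^{⊗(m+2)}, a^{⊗(n+1)})`, where `T f` is `f` after
multiplication of a new first strand into the last input of `f`, minus multiplication of the new
strand into the last output of `f`. For `n = 0` it is, in terms of elements,
`T f (b, c₁, …, cₘ, c) = f (c₁, …, cₘ, b c) - b f (c₁, …, cₘ, c)`. -/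
def T (a : C) [MonObj a] (m n : ℕ) :
    (tpowSucc a m ⟶ tpowSucc a n) →ₗ[R] (tpowSucc a (m + 1) ⟶ tpowSucc a n) where
  toFun f := mulLast a m ≫ f - a ◁ f ≫ mulLast a n
  map_add' f g := by simp; abel
  map_smul' r f := by simp [smul_sub]

/-- The iterate `T^k : C(a, a) ⟶ C(a^{⊗(k+1)}, a)`. -/
def iterT (a : C) [MonObj a] : (k : ℕ) → ((a ⟶ a) →ₗ[R] (tpowSucc a k ⟶ a))
  | 0 => LinearMap.id
  | k + 1 => (T R a k 0).comp (iterT a k)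

/-- The module `D_k(a)` of differential operators of order (at most) `k` on `a`: the maps
`Δ : a ⟶ a` with `T^{k+1} Δ = 0`. -/
def DiffOp (a : C) [MonObj a] (k : ℕ) : Submodule R (a ⟶ a) := LinearMap.ker (iterT R a (k + 1))

/-- A parity structure `(π, ξ)` on a linear symmetric monoidal category. -/
structure ParityStructure (C : Type u) [Category.{v} C] [Preadditive C] [MonoidalCategory C]
    [SymmetricCategory C] where
  π : C
  braiding_eq : (β_ π π).hom = -𝟙 (π ⊗ π)
  ξ : π ⊗ π ≅ 𝟙_ C

/-- The supermodule of maps `x ⟶ y` in the supercategory of `C`: a pair of an even part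
`x ⟶ y` and an odd part `π ⊗ x ⟶ y`. -/
abbrev SHom (P : ParityStructure C) (x y : C) := (x ⟶ y) × (P.π ⊗ x ⟶ y)

variable (P : ParityStructure C)

/-- The submodule of even elements of the supermodule of maps `x ⟶ y`. -/
def SHom.even (x y : C) : Submodule R (SHom P x y) := LinearMap.ker (LinearMap.snd R _ _)

/-- The submodule of odd elements of the supermodule of maps `x ⟶ y`. -/
def SHom.odd (x y : C) : Submodule R (SHom P x y) := LinearMap.ker (LinearMap.fst R _ _)

/-- Composition in the supercategory of `C` with an even map `g : x ⟶ y`. -/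
def SHom.precomp {x y : C} (g : x ⟶ y) (z : C) : SHom P y z →ₗ[R] SHom P x z where
  toFun f := (g ≫ f.1, P.π ◁ g ≫ f.2)
  map_add' f f' := by simp
  map_smul' r f := by simp

/-- The analogue of `T` for odd maps; the strand `π` is kept in the first position, hence is
exchanged with the new strand in the second term. -/
def oddT (a : C) [MonObj a] (m n : ℕ) :
    (P.π ⊗ tpowSucc a m ⟶ tpowSucc a n) →ₗ[R] (P.π ⊗ tpowSucc a (m + 1) ⟶ tpowSucc a n) where
  toFun f := P.π ◁ mulLast a m ≫ f - swapFirst P.π a (tpowSucc a m) ≫ a ◁ f ≫ mulLast a n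
  map_add' f g := by simp; abel
  map_smul' r f := by simp [smul_sub]

/-- The graded version of `T`. -/
def sT (a : C) [MonObj a] (m n : ℕ) :
    SHom P (tpowSucc a m) (tpowSucc a n) →ₗ[R] SHom P (tpowSucc a (m + 1)) (tpowSucc a n) :=
  (T R a m n).prodMap (oddT R P a m n)

/-- The iterates of the graded version of `T`. -/
def iterST (a : C) [MonObj a] : (k : ℕ) → (SHom P a a →ₗ[R] SHom P (tpowSucc a k) a)
  | 0 => LinearMap.id
  | k + 1 => (sT R P a k 0).comp (iterST a k)

/-- The supermodule of (even and odd) differential operators of order (at most) `k` on `a`. -/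
def SDiffOp (a : C) [MonObj a] (k : ℕ) : Submodule R (SHom P a a) :=
  LinearMap.ker (iterST R P a (k + 1))

theorem iterST_even (a : C) [MonObj a] (k : ℕ) (f : SHom P a a) :
    iterST R P a k (f.1, 0) = ((iterST R P a k f).1, 0) := by
  induction k with
  | zero => rfl
  | succ k ih => simp [iterST, ih, sT]

/-- `SDiffOp` is a graded sub-supermodule: it contains the even and odd parts of its elements. -/
theorem SDiffOp_parts (a : C) [MonObj a] (k : ℕ) {f : SHom P a a} (hf : f ∈ SDiffOp R P a k) :
    ((f.1, 0) : SHom P a a) ∈ SDiffOp R P a k ∧ ((0, f.2) : SHom P a a) ∈ SDiffOp R P a k := by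
  have h1 : ((f.1, 0) : SHom P a a) ∈ SDiffOp R P a k := by
    rw [SDiffOp, LinearMap.mem_ker] at hf ⊢
    rw [iterST_even, hf]
    rfl
  refine ⟨h1, ?_⟩
  have : ((0, f.2) : SHom P a a) = f - (f.1, 0) := by ext <;> simp
  rw [this]
  exact Submodule.sub_mem _ hf h1

end DiffOps

end SymDiff

/-!
A differential operator `Δ` of order at most `k` on a commutative monoid `a` is studied through
its commutators `[Δ, y] : p ↦ Δ (y p) - y Δ (p)` with generators `y`, which have order at most
`k - 1`. Since `y` ranges over an object rather than over elements, commutators carry a parameter: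
everything is proved for maps `V ⊗ a ⟶ a` with an arbitrary object `V`, and the commutator is a map
`(x ⊗ V) ⊗ a ⟶ a` (`genAd`). Ordinary operators are the case `V = 𝟙_ C` and odd operators the case
`V = π`; `mem_DiffOp_iff` and `mem_SDiffOp_iff` identify the iterates of `T` with iterated
commutators.

Uniqueness (`eq_zero_of_mem_diff`): if `Δ` vanishes on products of at most `k` generators, then
`[Δ, y]` vanishes on products of at most `k - 1` generators, hence is zero by induction on `k`.
So `Δ` commutes with the generators and vanishes at the unit; it therefore vanishes on all products
of generators, and these are jointly epic, also after tensoring with `V`, as `⊗` preserves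
epimorphisms.

Existence on `Sx` (`exists_mem_diff`): given `g : V ⊗ Sx ⟶ Sx`, induction yields an operator `δ` of
order at most `k - 1` that agrees with the commutator `[g, y]` on products of at most `k - 1`
generators. By uniqueness `[δ, y']` is symmetric in the two generators, because `[[g, y], y']` is.
This symmetry is exactly what is needed to integrate `δ` (`exists_genAd_eq`): there is a map `Δ`
with `[Δ, y] = δ` and prescribed value at the unit. Finally `Δ` has order at most `k`, since by the
Leibniz rule it suffices to test the order of a map on commutators with generators
(`mem_diff_succ_of_gen`).
-/

namespace SymDiff

set_option linter.unusedSectionVars false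

/-! ### Symmetries and actions -/

section Actions

variable {C : Type u} [Category.{v} C] [MonoidalCategory C] [SymmetricCategory C]

theorem swapFirst_swapFirst (X Y Z : C) : swapFirst X Y Z ≫ swapFirst Y X Z = 𝟙 _ := by
  have e : (β_ X Y).hom ▷ Z ≫ (β_ Y X).hom ▷ Z = 𝟙 _ := by
    rw [← comp_whiskerRight, SymmetricCategory.symmetry, id_whiskerRight]
  simp [swapFirst, reassoc_of% e]

instance (X Y Z : C) : IsIso (swapFirst X Y Z) :=
  ⟨swapFirst Y X Z, swapFirst_swapFirst _ _ _, swapFirst_swapFirst _ _ _⟩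

theorem swapFirst_nat_left {X X' : C} (f : X ⟶ X') (Y Z : C) :
    f ▷ (Y ⊗ Z) ≫ swapFirst X' Y Z = swapFirst X Y Z ≫ Y ◁ f ▷ Z := by
  simp only [swapFirst, Category.assoc]
  rw [associator_inv_naturality_left_assoc, ← comp_whiskerRight_assoc,
    BraidedCategory.braiding_naturality_left, comp_whiskerRight_assoc,
    associator_naturality_middle]

theorem swapFirst_nat_middle (X : C) {Y Y' : C} (f : Y ⟶ Y') (Z : C) :
    X ◁ f ▷ Z ≫ swapFirst X Y' Z = swapFirst X Y Z ≫ f ▷ (X ⊗ Z) := by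
  simp only [swapFirst, Category.assoc]
  rw [associator_inv_naturality_middle_assoc, ← comp_whiskerRight_assoc,
    BraidedCategory.braiding_naturality_right, comp_whiskerRight_assoc,
    associator_naturality_left]

/-- The Yang–Baxter equation for `swapFirst`, with a spectator `N`. -/
theorem swapFirst_yang_baxter (X Y Z N : C) :
    swapFirst X Y (Z ⊗ N) ≫ Y ◁ swapFirst X Z N ≫ swapFirst Y Z (X ⊗ N) =
      X ◁ swapFirst Y Z N ≫ swapFirst X Z (Y ⊗ N) ≫ Z ◁ swapFirst X Y N := by
  have h := congrArg (fun t => 𝟙 (X ⊗ Y ⊗ Z ⊗ N) ⊗≫ t ▷ N ⊗≫ 𝟙 (Z ⊗ Y ⊗ X ⊗ N))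
    (BraidedCategory.yang_baxter X Y Z)
  simp only [swapFirst]
  calc _ = 𝟙 (X ⊗ Y ⊗ Z ⊗ N) ⊗≫ ((α_ X Y Z).inv ≫ (β_ X Y).hom ▷ Z ≫ (α_ Y X Z).hom ≫
      Y ◁ (β_ X Z).hom ≫ (α_ Y Z X).inv ≫ (β_ Y Z).hom ▷ X ≫ (α_ Z Y X).hom) ▷ N ⊗≫
        𝟙 (Z ⊗ Y ⊗ X ⊗ N) := by monoidal
    _ = _ := h
    _ = _ := by monoidal

/-- The hexagon identity for `swapFirst`. -/
theorem swapFirst_associator (a X Y Z : C) :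
    a ◁ (α_ X Y Z).hom ≫ swapFirst a X (Y ⊗ Z) ≫ X ◁ swapFirst a Y Z =
      swapFirst a (X ⊗ Y) Z ≫ (α_ X Y (a ⊗ Z)).hom := by
  simp only [swapFirst, BraidedCategory.braiding_tensor_right_hom]
  monoidal

/-- The action of `a` on `W ⊗ M` through an action `act` on `M`; in terms of elements,
`b (w, m) = (w, b m)`. The map `act` is not required to satisfy the laws of an action. -/
def swapAct {a M : C} (W : C) (act : a ⊗ M ⟶ M) : a ⊗ (W ⊗ M) ⟶ W ⊗ M :=
  swapFirst a W M ≫ W ◁ act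

/-- `φ` commutes with the maps `act` and `act'`, regarded as actions of `a`. -/
def IsActHom {a M N : C} (act : a ⊗ M ⟶ M) (act' : a ⊗ N ⟶ N) (φ : M ⟶ N) : Prop :=
  act ≫ φ = a ◁ φ ≫ act'

namespace IsActHom

variable {a M N K : C} {act : a ⊗ M ⟶ M} {act' : a ⊗ N ⟶ N} {act'' : a ⊗ K ⟶ K}

theorem comp {φ : M ⟶ N} {ψ : N ⟶ K} (h : IsActHom act act' φ) (h' : IsActHom act' act'' ψ) :
    IsActHom act act'' (φ ≫ ψ) := by
  unfold IsActHom at *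
  rw [reassoc_of% h, h', whiskerLeft_comp, Category.assoc]

theorem inv {φ : M ≅ N} (h : IsActHom act act' φ.hom) : IsActHom act' act φ.inv := by
  unfold IsActHom at *
  rw [Iso.comp_inv_eq, Category.assoc, h, ← whiskerLeft_comp_assoc]
  simp

theorem whiskerLeft {φ : M ⟶ N} (h : IsActHom act act' φ) (W : C) :
    IsActHom (swapAct W act) (swapAct W act') (W ◁ φ) := by
  unfold IsActHom swapAct at *
  rw [reassoc_of% swapFirst_nat, Category.assoc, ← whiskerLeft_comp, h, whiskerLeft_comp]

theorem whiskerRight {W W' : C} (w : W ⟶ W') (act : a ⊗ M ⟶ M) :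
    IsActHom (swapAct W act) (swapAct W' act) (w ▷ M) := by
  unfold IsActHom swapAct
  rw [reassoc_of% swapFirst_nat_middle, Category.assoc, whisker_exchange]

theorem swapFirst (W W' : C) (act : a ⊗ M ⟶ M) :
    IsActHom (swapAct W (swapAct W' act)) (swapAct W' (swapAct W act)) (swapFirst W W' M) := by
  unfold IsActHom swapAct
  simp only [whiskerLeft_comp, Category.assoc]
  rw [swapFirst_nat, reassoc_of% swapFirst_yang_baxter]

theorem associator (W W' : C) (act : a ⊗ M ⟶ M) :
    IsActHom (swapAct (W ⊗ W') act) (swapAct W (swapAct W' act)) (α_ W W' M).hom := by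
  unfold IsActHom swapAct
  rw [whiskerLeft_comp, reassoc_of% swapFirst_associator, Category.assoc,
    associator_naturality_right]

theorem leftUnitor (act : a ⊗ M ⟶ M) : IsActHom (swapAct (𝟙_ C) act) act (λ_ M).hom := by
  unfold IsActHom swapAct SymDiff.swapFirst
  simp

end IsActHom

/-- Commutativity of `a`: multiplication `b, c ↦ b c` is linear in `c` over `a`, for the action
of `a` on `a ⊗ a` through the second factor. -/
theorem isActHom_mul (a : C) [MonObj a] [IsCommMonObj a] :
    IsActHom (swapAct a (MonObj.mul (X := a))) MonObj.mul MonObj.mul := by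
  have h : (β_ a a).hom ▷ a ≫ MonObj.mul ▷ a = MonObj.mul ▷ a := by
    rw [← comp_whiskerRight, IsCommMonObj.mul_comm]
  unfold IsActHom swapAct swapFirst
  simp only [Category.assoc]
  rw [← MonObj.mul_assoc, reassoc_of% h, MonObj.mul_assoc, Iso.inv_hom_id_assoc]

/-- If `act` is a homomorphism of actions, which expresses that multiplications by elements
of `a` commute, then so is the induced action on `V ⊗ M`. -/
theorem IsActHom.swapAct_self {a M : C} {act : a ⊗ M ⟶ M} (h : IsActHom (swapAct a act) act act)
    (V : C) : IsActHom (swapAct a (swapAct V act)) (swapAct V act) (swapAct V act) :=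
  (IsActHom.swapFirst a V act).comp (h.whiskerLeft V)

end Actions

/-! ### Iterated commutators and differential operators -/

section Diff

variable {C : Type u} [Category.{v} C] [Preadditive C] [MonoidalCategory C] [SymmetricCategory C]
  [MonoidalPreadditive C]

/-- The commutator of a map `f : M ⟶ a` with the multiplications by elements of `a`:
`(b, m) ↦ f (b m) - b f m`. -/
def ad {a M : C} [MonObj a] (act : a ⊗ M ⟶ M) : (M ⟶ a) →+ (a ⊗ M ⟶ a) where
  toFun f := act ≫ f - a ◁ f ≫ MonObj.mul
  map_zero' := by simp
  map_add' f g := by simp; abel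

/-- The maps `M ⟶ a` whose `k`-fold commutators with multiplications vanish, that is,
the differential operators of order less than `k` (not at most `k`). The commutator has source
`a ⊗ M`, on which `a` acts through `M`. -/
def diff {a : C} [MonObj a] : {M : C} → (a ⊗ M ⟶ M) → ℕ → AddSubgroup (M ⟶ a)
  | _, _, 0 => ⊥
  | _, act, k + 1 => (diff (swapAct a act) k).comap (ad act)

variable {a M N : C} [MonObj a]

theorem ad_apply (act : a ⊗ M ⟶ M) (f : M ⟶ a) : ad act f = act ≫ f - a ◁ f ≫ MonObj.mul := rfl

theorem mem_diff_zero {act : a ⊗ M ⟶ M} {f : M ⟶ a} : f ∈ diff act 0 ↔ f = 0 :=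
  AddSubgroup.mem_bot

theorem mem_diff_succ {act : a ⊗ M ⟶ M} {f : M ⟶ a} {k : ℕ} :
    f ∈ diff act (k + 1) ↔ ad act f ∈ diff (swapAct a act) k := Iff.rfl

theorem ad_comp {act : a ⊗ M ⟶ M} {act' : a ⊗ N ⟶ N} {φ : M ⟶ N} (h : IsActHom act act' φ)
    (f : N ⟶ a) : ad act (φ ≫ f) = a ◁ φ ≫ ad act' f := by
  unfold IsActHom at h
  simp [ad_apply, reassoc_of% h]

theorem comp_mem_diff {act : a ⊗ M ⟶ M} {act' : a ⊗ N ⟶ N} {φ : M ⟶ N}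
    (h : IsActHom act act' φ) {k : ℕ} {f : N ⟶ a} (hf : f ∈ diff act' k) :
    φ ≫ f ∈ diff act k := by
  induction k generalizing M N with
  | zero => rw [mem_diff_zero] at *; simp [hf]
  | succ k ih =>
    rw [mem_diff_succ] at *
    rw [ad_comp h]
    exact ih (h.whiskerLeft a) hf

theorem iso_comp_mem_diff {act : a ⊗ M ⟶ M} {act' : a ⊗ N ⟶ N} {φ : M ≅ N}
    (h : IsActHom act act' φ.hom) {k : ℕ} {f : N ⟶ a} :
    φ.hom ≫ f ∈ diff act k ↔ f ∈ diff act' k :=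
  ⟨fun hf => by simpa using comp_mem_diff h.inv hf, comp_mem_diff h⟩

/-- The action `mulLast` on `a^{⊗(m+1)}` is the `m`-fold iterate of `swapAct a` on the
multiplication, so `T` is the commutator `ad`. -/
theorem mem_diff_iterT {a : C} [MonObj a] (R : Type w) [CommRing R] [Linear R C]
    [MonoidalLinear R C] (Δ : a ⟶ a) (j m : ℕ) :
    iterT R a m Δ ∈ diff (mulLast a m) j ↔ iterT R a (m + j) Δ = 0 := by
  induction j generalizing m with
  | zero => rw [mem_diff_zero]; rfl
  | succ j ih =>
    rw [show m + (j + 1) = m + 1 + j by omega, ← ih (m + 1)]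
    exact mem_diff_succ

/-- The odd version of `T` is the commutator on `π ⊗ a^{⊗(m+1)}`, up to the isomorphism of
actions that exchanges `π` with the new strand. -/
theorem mem_diff_iterST_snd {a : C} [MonObj a] (R : Type w) [CommRing R] [Linear R C]
    [MonoidalLinear R C] (P : ParityStructure C) (Δ : SHom P a a) (j m : ℕ) :
    (iterST R P a m Δ).2 ∈ diff (swapAct P.π (mulLast a m)) j ↔
      (iterST R P a (m + j) Δ).2 = 0 := by
  induction j generalizing m with
  | zero => rw [mem_diff_zero]; rfl
  | succ j ih =>
    rw [show m + (j + 1) = m + 1 + j by omega, ← ih (m + 1), mem_diff_succ]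
    have e : (iterST R P a (m + 1) Δ).2 =
        swapFirst P.π a _ ≫ ad (swapAct P.π (mulLast a m)) (iterST R P a m Δ).2 := by
      change P.π ◁ mulLast a m ≫ _ - swapFirst P.π a (tpowSucc a m) ≫ a ◁ _ ≫ mulLast a 0 = _
      rw [ad_apply, Preadditive.comp_sub, swapAct, Category.assoc,
        reassoc_of% swapFirst_swapFirst P.π a (tpowSucc a m)]
      rfl
    have h := IsActHom.swapFirst P.π a (mulLast a m)
    rw [e]
    exact (iso_comp_mem_diff (φ := ⟨swapFirst P.π a _, swapFirst a P.π _,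
      swapFirst_swapFirst _ _ _, swapFirst_swapFirst _ _ _⟩) h).symm

theorem mem_DiffOp_iff {a : C} [MonObj a] (R : Type w) [CommRing R] [Linear R C]
    [MonoidalLinear R C] {k : ℕ} {Δ : a ⟶ a} :
    Δ ∈ DiffOp R a k ↔ Δ ∈ diff MonObj.mul (k + 1) := by
  rw [DiffOp, LinearMap.mem_ker, ← Nat.zero_add (k + 1), ← mem_diff_iterT R Δ (k + 1) 0,
    Nat.zero_add]
  rfl

theorem iterST_fst {a : C} [MonObj a] (R : Type w) [CommRing R] [Linear R C]
    [MonoidalLinear R C] (P : ParityStructure C) (Δ : SHom P a a) (k : ℕ) :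
    (iterST R P a k Δ).1 = iterT R a k Δ.1 := by
  induction k with
  | zero => rfl
  | succ k ih => exact congrArg (T R a k 0) ih

theorem mem_SDiffOp_iff {a : C} [MonObj a] (R : Type w) [CommRing R] [Linear R C]
    [MonoidalLinear R C] (P : ParityStructure C) {k : ℕ} {Δ : SHom P a a} :
    Δ ∈ SDiffOp R P a k ↔
      Δ.1 ∈ diff MonObj.mul (k + 1) ∧ Δ.2 ∈ diff (swapAct P.π MonObj.mul) (k + 1) := by
  rw [← mem_DiffOp_iff R, DiffOp, LinearMap.mem_ker, SDiffOp, LinearMap.mem_ker, Prod.ext_iff,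
    iterST_fst]
  have h := mem_diff_iterST_snd R P Δ (k + 1) 0
  rw [Nat.zero_add] at h
  exact and_congr_right' h.symm

end Diff

/-! ### Commutators with generators and uniqueness -/

section GenAd

variable {C : Type u} [Category.{v} C] [Preadditive C] [MonoidalCategory C] [SymmetricCategory C]
  [MonoidalPreadditive C]

theorem whiskerLeft_sub (X : C) {Y Z : C} (f g : Y ⟶ Z) : X ◁ (f - g) = X ◁ f - X ◁ g :=
  (tensorLeft X).map_sub

/-- The commutator of a map `f : V ⊗ a ⟶ a` with multiplications by elements of `x`, where
`m : x ⊗ a ⟶ a` is the multiplication. In terms of elements it is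
`(y, v, p) ↦ f (v, y p) - y f (v, p)`. The source is bracketed as `(x ⊗ V) ⊗ a`, so that it is
again of the form of the source of `f`. -/
def genAd {x a : C} (m : x ⊗ a ⟶ a) {V : C} : (V ⊗ a ⟶ a) →+ ((x ⊗ V) ⊗ a ⟶ a) where
  toFun f := (α_ x V a).hom ≫ (swapFirst x V a ≫ V ◁ m ≫ f - x ◁ f ≫ m)
  map_zero' := by simp
  map_add' f g := by simp; abel

theorem genAd_apply {x a : C} (m : x ⊗ a ⟶ a) {V : C} (f : V ⊗ a ⟶ a) :
    genAd m f = (α_ x V a).hom ≫ (swapFirst x V a ≫ V ◁ m ≫ f - x ◁ f ≫ m) := rfl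

theorem genAd_eq {x a : C} [MonObj a] (c : x ⟶ a) {V : C} (f : V ⊗ a ⟶ a) :
    genAd (c ▷ a ≫ MonObj.mul) f =
      (α_ x V a).hom ≫ c ▷ (V ⊗ a) ≫ ad (swapAct V MonObj.mul) f := by
  rw [genAd_apply, ad_apply, swapAct, Preadditive.comp_sub (f := c ▷ (V ⊗ a))]
  congr 2
  · rw [Category.assoc, reassoc_of% swapFirst_nat_left, whiskerLeft_comp_assoc]
  · rw [← whisker_exchange_assoc]

theorem genAd_mem_diff {x a : C} [MonObj a] (c : x ⟶ a) {V : C} {k : ℕ} {f : V ⊗ a ⟶ a}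
    (hf : f ∈ diff (swapAct V MonObj.mul) (k + 1)) :
    genAd (c ▷ a ≫ MonObj.mul) f ∈ diff (swapAct (x ⊗ V) MonObj.mul) k := by
  rw [genAd_eq]
  exact comp_mem_diff (IsActHom.associator x V _)
    (comp_mem_diff (IsActHom.whiskerRight c _) hf)

theorem whiskerLeft_genAd {x a : C} (m : x ⊗ a ⟶ a) {V N : C} (f : V ⊗ a ⟶ a)
    (t : N ⟶ a) (t' : x ⊗ N ⟶ a) (ht : x ◁ t ≫ m = t') :
    (x ⊗ V) ◁ t ≫ genAd m f =
      (α_ x V N).hom ≫ (swapFirst x V N ≫ V ◁ t' ≫ f - x ◁ (V ◁ t ≫ f) ≫ m) := by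
  rw [genAd_apply, associator_naturality_right_assoc, Preadditive.comp_sub (f := x ◁ V ◁ t),
    reassoc_of% swapFirst_nat, ← whiskerLeft_comp_assoc V, ht, whiskerLeft_comp x,
    Category.assoc]

theorem genAd_associator {x a : C} (m : x ⊗ a ⟶ a) {V : C} (g : x ⊗ (V ⊗ a) ⟶ a) :
    genAd m ((α_ x V a).hom ≫ g) = (α_ x (x ⊗ V) a).hom ≫ x ◁ (α_ x V a).hom ≫
      (swapFirst x x (V ⊗ a) ≫ x ◁ (swapFirst x V a ≫ V ◁ m) ≫ g - x ◁ g ≫ m) := by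
  rw [genAd_apply]
  congr 1
  simp only [Preadditive.comp_sub, whiskerLeft_comp, Category.assoc]
  rw [reassoc_of% swapFirst_associator, associator_naturality_right_assoc]

theorem swapFirst_whiskerRight_associator (X Y Z N : C) :
    swapFirst X Y Z ▷ N ≫ (α_ Y (X ⊗ Z) N).hom ≫ Y ◁ (α_ X Z N).hom =
      (α_ X (Y ⊗ Z) N).hom ≫ X ◁ (α_ Y Z N).hom ≫ swapFirst X Y (Z ⊗ N) := by
  simp only [swapFirst]
  monoidal

/-- If the multiplications `m` by elements of `x` commute, then so do the induced ones on
`V ⊗ a`. -/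
theorem swapFirst_whiskerLeft_comm {x a : C} {m : x ⊗ a ⟶ a}
    (hm : swapFirst x x a ≫ x ◁ m ≫ m = x ◁ m ≫ m) (V : C) :
    swapFirst x x (V ⊗ a) ≫ x ◁ (swapFirst x V a ≫ V ◁ m) ≫ swapFirst x V a ≫ V ◁ m =
      x ◁ (swapFirst x V a ≫ V ◁ m) ≫ swapFirst x V a ≫ V ◁ m := by
  simp only [whiskerLeft_comp, Category.assoc]
  rw [reassoc_of% swapFirst_nat, reassoc_of% swapFirst_yang_baxter, ← whiskerLeft_comp,
    ← whiskerLeft_comp, hm, whiskerLeft_comp]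

/-- Commutators with commuting multiplications commute. -/
theorem swap_genAd_genAd {x a : C} {m : x ⊗ a ⟶ a}
    (hm : swapFirst x x a ≫ x ◁ m ≫ m = x ◁ m ≫ m) {V : C} (f : V ⊗ a ⟶ a) :
    swapFirst x x V ▷ a ≫ genAd m (genAd m f) = genAd m (genAd m f) := by
  have e := swapFirst_whiskerRight_associator x x V a
  have hV := swapFirst_whiskerLeft_comm hm V
  rw [genAd_apply m f, genAd_associator, reassoc_of% e]
  congr 2
  simp only [Preadditive.comp_sub, whiskerLeft_sub, Preadditive.sub_comp,
    reassoc_of% swapFirst_swapFirst]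
  have h1 := hV =≫ f
  simp only [whiskerLeft_comp, Category.assoc] at h1 ⊢
  rw [h1, ← reassoc_of% swapFirst_nat, hm]
  have h2 := swapFirst x x (V ⊗ a) ≫= h1
  simp only [reassoc_of% swapFirst_swapFirst] at h2
  rw [h2]
  abel

section Inj

variable [TensorCocomplete C]

/-- A map that commutes with the generators and vanishes at the unit vanishes on all products
of generators, which are jointly epic. -/
theorem genAd_eq_zero {x a : C} [MonObj a] [IsCommMonObj a] (c : x ⟶ a) [Epi (lift c)] {V : C}
    {f : V ⊗ a ⟶ a} (h0 : V ◁ MonObj.one ≫ f = 0) (h : genAd (c ▷ a ≫ MonObj.mul) f = 0) :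
    f = 0 := by
  have h1 : swapFirst x V a ≫ V ◁ (c ▷ a ≫ MonObj.mul) ≫ f = x ◁ f ≫ c ▷ a ≫ MonObj.mul := by
    rw [genAd_apply, Preadditive.IsIso.comp_left_eq_zero] at h
    exact sub_eq_zero.1 h
  have : Epi (V ◁ lift c) := inferInstanceAs (Epi ((tensorLeft V).map (lift c)))
  rw [← cancel_epi (V ◁ lift c), comp_zero]
  refine toSym_hom_ext (tensorLeft V) fun n => ?_
  change V ◁ toSym x n ≫ _ = V ◁ toSym x n ≫ _
  rw [comp_zero, ← whiskerLeft_comp_assoc, toSym_lift]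
  induction n with
  | zero => exact h0
  | succ n ih =>
    rw [mulPow, tensorHom_def', Category.assoc, ← cancel_epi (swapFirst x V (tpow x n)),
      whiskerLeft_comp, Category.assoc, ← reassoc_of% swapFirst_nat, h1,
      ← whiskerLeft_comp_assoc x, ih]
    simp

/-- A differential operator of order less than `k` is determined by its values on products
of less than `k` generators: its commutator with generators has order less than `k - 1` and
vanishes on products of less than `k - 1` generators. -/
theorem eq_zero_of_mem_diff {x a : C} [MonObj a] [IsCommMonObj a] (c : x ⟶ a) [Epi (lift c)]
    {k : ℕ} {V : C} {f : V ⊗ a ⟶ a} (hf : f ∈ diff (swapAct V MonObj.mul) k)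
    (h : ∀ n < k, V ◁ mulPow c n ≫ f = 0) : f = 0 := by
  induction k generalizing V with
  | zero => exact mem_diff_zero.1 hf
  | succ k ih =>
    refine genAd_eq_zero c (h 0 k.succ_pos) (ih (genAd_mem_diff c hf) fun n hn => ?_)
    rw [whiskerLeft_genAd _ _ _ (mulPow c (n + 1)), h _ (by omega), h _ (by omega)]
    · simp
    · rw [mulPow, tensorHom_def', Category.assoc]

end Inj
end GenAd

/-! ### Testing the order on generators -/

section Generators

variable {C : Type u} [Category.{v} C] [Preadditive C] [MonoidalCategory C] [SymmetricCategory C]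
  [MonoidalPreadditive C]

theorem whiskerLeft_mul_gen {x a : C} [MonObj a] [IsCommMonObj a] (c : x ⟶ a) :
    a ◁ (c ▷ a ≫ MonObj.mul) ≫ MonObj.mul =
      swapFirst a x a ≫ x ◁ MonObj.mul ≫ c ▷ a ≫ MonObj.mul := by
  have h := isActHom_mul a
  unfold IsActHom swapAct at h
  rw [whiskerLeft_comp, Category.assoc, ← h, Category.assoc, reassoc_of% swapFirst_nat_middle,
    whisker_exchange_assoc]

theorem ad_whiskerLeft_comp {x a N : C} [MonObj a] [IsCommMonObj a] (c : x ⟶ a)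
    (act : a ⊗ N ⟶ N) (F : N ⟶ a) :
    ad (swapAct x act) (x ◁ F ≫ c ▷ a ≫ MonObj.mul) =
      swapFirst a x N ≫ x ◁ ad act F ≫ c ▷ a ≫ MonObj.mul := by
  rw [ad_apply, ad_apply, swapAct, whiskerLeft_sub, Preadditive.sub_comp, Preadditive.comp_sub]
  congr 1
  · simp
  · rw [whiskerLeft_comp a, Category.assoc, whiskerLeft_mul_gen, reassoc_of% swapFirst_nat]
    simp

/-- Multiplying the values by elements of `a` preserves the order of differential operators. -/
theorem whiskerLeft_comp_mem_diff {x a N : C} [MonObj a] [IsCommMonObj a] (c : x ⟶ a)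
    {act : a ⊗ N ⟶ N} {F : N ⟶ a} {k : ℕ} (hF : F ∈ diff act k) :
    x ◁ F ≫ c ▷ a ≫ MonObj.mul ∈ diff (swapAct x act) k := by
  induction k generalizing N with
  | zero => rw [mem_diff_zero] at *; simp [hF]
  | succ k ih =>
    rw [mem_diff_succ, ad_whiskerLeft_comp]
    exact comp_mem_diff (IsActHom.swapFirst a x act) (ih hF)

/-- The Leibniz rule `[Δ, y p] = [Δ, y] p + y [Δ, p]`. -/
theorem mul_whiskerRight_ad {x a M : C} [MonObj a] (c : x ⟶ a) {act : a ⊗ M ⟶ M}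
    (hact : MonObj.mul ▷ M ≫ act = (α_ a a M).hom ≫ a ◁ act ≫ act) (f : M ⟶ a) :
    (c ▷ a ≫ MonObj.mul) ▷ M ≫ ad act f = (α_ x a M).hom ≫
      (x ◁ act ≫ c ▷ M ≫ ad act f + x ◁ ad act f ≫ c ▷ a ≫ MonObj.mul) := by
  have h1 : (c ▷ a ≫ MonObj.mul) ▷ M ≫ act ≫ f =
      (α_ x a M).hom ≫ x ◁ act ≫ c ▷ M ≫ act ≫ f := by
    rw [comp_whiskerRight_assoc, reassoc_of% hact, associator_naturality_left_assoc,
      whisker_exchange_assoc]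
  have h2 : (c ▷ a ≫ MonObj.mul) ▷ M ≫ a ◁ f ≫ MonObj.mul =
      (α_ x a M).hom ≫ x ◁ a ◁ f ≫ x ◁ MonObj.mul ≫ c ▷ a ≫ MonObj.mul := by
    rw [comp_whiskerRight_assoc, ← whisker_exchange_assoc, MonObj.mul_assoc,
      ← whisker_exchange_assoc (c ▷ a) f, associator_naturality_left_assoc,
      associator_naturality_right_assoc, whisker_exchange_assoc c MonObj.mul]
  simp only [ad_apply, Preadditive.comp_sub, whiskerLeft_sub, Preadditive.sub_comp,
    Preadditive.comp_add, h1, h2, whiskerLeft_comp, Category.assoc]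
  rw [← whisker_exchange_assoc c f]
  abel

variable [TensorCocomplete C]

/-- The order of a differential operator on `F (Sx)` can be tested on the maps
`F (x^{⊗n}) ⟶ F (Sx)`, which are jointly epic. -/
theorem mem_diff_of_toSym {x a : C} [MonObj a] (F : C ⥤ C) [PreservesColimits F]
    {act : a ⊗ F.obj (Sym x) ⟶ F.obj (Sym x)}
    {act' : ∀ n, a ⊗ F.obj (tpow x n) ⟶ F.obj (tpow x n)}
    (h : ∀ n, IsActHom (act' n) act (F.map (toSym x n))) {k : ℕ} {f : F.obj (Sym x) ⟶ a}
    (hf : ∀ n, F.map (toSym x n) ≫ f ∈ diff (act' n) k) : f ∈ diff act k := by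
  induction k generalizing F with
  | zero => exact mem_diff_zero.2 (toSym_hom_ext F fun n => by
      rw [comp_zero]; exact mem_diff_zero.1 (hf n))
  | succ k ih =>
    refine ih (F ⋙ tensorLeft a) (fun n => (h n).whiskerLeft a) fun n => ?_
    have := hf n
    rw [mem_diff_succ, ad_comp (h n)] at this
    exact this

/-- The order of a differential operator on a module over `Sx` can be tested on commutators
with the generators: by the Leibniz rule, commutators with products of generators are sums of
such operators. -/
theorem mem_diff_succ_of_gen {x M : C} {act : Sym x ⊗ M ⟶ M}
    (hcomm : IsActHom (swapAct (Sym x) act) act act)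
    (hone : MonObj.one ▷ M ≫ act = (λ_ M).hom)
    (hmul : MonObj.mul ▷ M ≫ act = (α_ _ _ M).hom ≫ Sym x ◁ act ≫ act) {f : M ⟶ Sym x} {k : ℕ}
    (hf : symGen x ▷ M ≫ ad act f ∈ diff (swapAct x act) k) : f ∈ diff act (k + 1) := by
  refine mem_diff_of_toSym (tensorRight M) (act' := fun n => swapAct (tpow x n) act)
    (fun n => IsActHom.whiskerRight _ _) fun n => ?_
  change toSym x n ▷ M ≫ ad act f ∈ _
  induction n with
  | zero =>
    have : toSym x 0 ▷ M ≫ ad act f = 0 := by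
      change MonObj.one ▷ M ≫ _ = _
      rw [ad_apply, Preadditive.comp_sub, reassoc_of% hone, ← whisker_exchange_assoc,
        MonObj.one_mul]
      simp
    rw [this]
    exact zero_mem _
  | succ n ih =>
    have e : toSym x (n + 1) ▷ M ≫ ad act f = (α_ x (tpow x n) M).hom ≫
        (x ◁ (toSym x n ▷ M ≫ act) ≫ symGen x ▷ M ≫ ad act f +
          x ◁ (toSym x n ▷ M ≫ ad act f) ≫ symGen x ▷ Sym x ≫ MonObj.mul) := by
      have : toSym x (n + 1) = x ◁ toSym x n ≫ symGen x ▷ Sym x ≫ MonObj.mul := by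
        rw [← symCons_spec, ← symGen_mul]
        rfl
      rw [this, comp_whiskerRight_assoc, mul_whiskerRight_ad _ hmul,
        associator_naturality_middle_assoc, Preadditive.comp_add (f := x ◁ toSym x n ▷ M)]
      simp only [whiskerLeft_comp, Category.assoc]
    rw [e]
    refine comp_mem_diff (IsActHom.associator x (tpow x n) act) (add_mem ?_ ?_)
    · exact comp_mem_diff (((IsActHom.whiskerRight _ _).comp hcomm).whiskerLeft x) hf
    · exact whiskerLeft_comp_mem_diff _ ih

theorem mem_diff_succ_of_genAd {x V : C} {f : V ⊗ Sym x ⟶ Sym x} {k : ℕ}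
    (hf : genAd (symCons x) f ∈ diff (swapAct (x ⊗ V) MonObj.mul) k) :
    f ∈ diff (swapAct V MonObj.mul) (k + 1) := by
  have hS : symGen x ▷ Sym x ≫ MonObj.mul = symCons x := symGen_mul x
  refine mem_diff_succ_of_gen ((isActHom_mul _).swapAct_self V) ?_ ?_ ?_
  · rw [swapAct, reassoc_of% swapFirst_nat_left, ← whiskerLeft_comp, MonObj.one_mul, swapFirst]
    simp
  · simp only [swapAct, whiskerLeft_comp, Category.assoc]
    rw [reassoc_of% swapFirst_nat_left, ← whiskerLeft_comp, MonObj.mul_assoc,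
      reassoc_of% swapFirst_nat]
    simp only [whiskerLeft_comp, swapFirst, BraidedCategory.braiding_tensor_left_hom]
    monoidal
  · rw [← hS, genAd_eq] at hf
    exact (iso_comp_mem_diff (IsActHom.associator x V _)).1 hf

end Generators

/-! ### Integration of commutators -/

section Integration

variable {C : Type u} [Category.{v} C] [Preadditive C] [MonoidalCategory C] [SymmetricCategory C]
  [MonoidalPreadditive C] [TensorCocomplete C]

/-- Integration: a map `δ` is the commutator with the generators of some map `Δ` as soon as its
own commutator with the generators is symmetric, and `Δ` may be prescribed at the unit. -/
theorem exists_genAd_eq {x V : C} (δ : (x ⊗ V) ⊗ Sym x ⟶ Sym x)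
    (hδ : swapFirst x x V ▷ Sym x ≫ genAd (symCons x) δ = genAd (symCons x) δ)
    (g : V ⊗ 𝟙_ C ⟶ Sym x) :
    ∃ Δ : V ⊗ Sym x ⟶ Sym x, V ◁ symOne x ≫ Δ = g ∧ genAd (symCons x) Δ = δ := by
  have : HasBinaryBiproducts C := HasBinaryBiproducts.of_hasBinaryCoproducts
  obtain ⟨d, rfl⟩ : ∃ d, δ = (α_ x V (Sym x)).hom ≫ d := ⟨(α_ x V (Sym x)).inv ≫ δ, by simp⟩
  let c : x ⊗ (V ⊗ Sym x) ⟶ V ⊗ Sym x := swapFirst x V (Sym x) ≫ V ◁ symCons x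
  have hc : swapFirst x x (V ⊗ Sym x) ≫ x ◁ c ≫ c = x ◁ c ≫ c :=
    swapFirst_whiskerLeft_comm (symCons_swap x) V
  have hd : swapFirst x x (V ⊗ Sym x) ≫ (x ◁ d ≫ symCons x + x ◁ c ≫ d) =
      x ◁ d ≫ symCons x + x ◁ c ≫ d := by
    rw [genAd_associator, reassoc_of% swapFirst_whiskerRight_associator, cancel_epi,
      cancel_epi, Preadditive.comp_sub, reassoc_of% swapFirst_swapFirst,
      sub_eq_sub_iff_add_eq_add] at hδ
    rw [Preadditive.comp_add, add_comm]
    exact hδ.symm.trans (add_comm _ _)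
  -- The recursion `Δ (v, y ω) = y Δ (v, ω) + δ (y, v, ω)` is inhomogeneous. It is solved by the
  -- homogeneous recursion for the pair `(Δ (v, ω), v ⊗ ω)`, on which `y` acts by
  -- `y (r, s) = (y r + δ (y, s), y s)`; symmetry of the commutator of `δ` says that these
  -- actions commute, so that the iterated action factors through `Sx`.
  let p : Sym x ⊞ (V ⊗ Sym x) ⟶ Sym x := biprod.fst
  let q : Sym x ⊞ (V ⊗ Sym x) ⟶ V ⊗ Sym x := biprod.snd
  let act : x ⊗ (Sym x ⊞ (V ⊗ Sym x)) ⟶ Sym x ⊞ (V ⊗ Sym x) :=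
    biprod.lift (x ◁ p ≫ symCons x + x ◁ q ≫ d) (x ◁ q ≫ c)
  have hp : act ≫ p = x ◁ p ≫ symCons x + x ◁ q ≫ d := biprod.lift_fst _ _
  have hq : act ≫ q = x ◁ q ≫ c := biprod.lift_snd _ _
  have hp2 : x ◁ act ≫ act ≫ p = x ◁ x ◁ p ≫ x ◁ symCons x ≫ symCons x +
      x ◁ x ◁ q ≫ (x ◁ d ≫ symCons x + x ◁ c ≫ d) := by
    rw [hp, Preadditive.comp_add, ← whiskerLeft_comp_assoc, ← whiskerLeft_comp_assoc, hp, hq]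
    simp only [MonoidalPreadditive.whiskerLeft_add, Preadditive.add_comp, Preadditive.comp_add,
      whiskerLeft_comp, Category.assoc]
    abel
  have hq2 : x ◁ act ≫ act ≫ q = x ◁ x ◁ q ≫ x ◁ c ≫ c := by
    rw [hq, ← whiskerLeft_comp_assoc, hq]
    simp only [whiskerLeft_comp, Category.assoc]
  have hact : swapFirst x x _ ≫ x ◁ act ≫ act = x ◁ act ≫ act := by
    refine biprod.hom_ext _ _ ?_ ?_
    · change (_ ≫ _ ≫ _) ≫ p = (_ ≫ _) ≫ p
      simp only [Category.assoc]
      rw [hp2, Preadditive.comp_add (f := swapFirst x x _), ← reassoc_of% swapFirst_nat,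
        ← reassoc_of% swapFirst_nat, hd, symCons_swap]
    · change (_ ≫ _ ≫ _) ≫ q = (_ ≫ _) ≫ q
      simp only [Category.assoc]
      rw [hq2, ← reassoc_of% swapFirst_nat, hc]
  let e : V ⟶ Sym x ⊞ (V ⊗ Sym x) :=
    biprod.lift ((ρ_ V).inv ≫ g) ((ρ_ V).inv ≫ V ◁ symOne x)
  obtain ⟨Φ, hΦ⟩ := exists_desc (tensorRight V) (fun n => iter act e n)
    fun n s => permMap_iter hact e n s
  replace hΦ : ∀ n, toSym x n ▷ V ≫ Φ = iter act e n := hΦ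
  have hΦ0 : symOne x ▷ V ≫ Φ = (λ_ V).hom ≫ e := hΦ 0
  have hΦ1 : symCons x ▷ V ≫ Φ = (α_ x (Sym x) V).hom ≫ x ◁ Φ ≫ act := by
    refine toSym_hom_ext (tensorLeft x ⋙ tensorRight V) fun n => ?_
    change (x ◁ toSym x n) ▷ V ≫ _ = (x ◁ toSym x n) ▷ V ≫ _
    rw [← comp_whiskerRight_assoc, symCons_spec, hΦ, associator_naturality_middle_assoc,
      ← whiskerLeft_comp_assoc, hΦ]
    rfl
  have hβ : symCons x ▷ V ≫ (β_ (Sym x) V).hom =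
      (α_ x (Sym x) V).hom ≫ x ◁ (β_ (Sym x) V).hom ≫ c := by
    rw [BraidedCategory.braiding_naturality_left]
    simp [c, swapFirst, BraidedCategory.braiding_tensor_left_hom]
  -- The second component of the pair is indeed `v ⊗ ω`.
  have hΦq : Φ ≫ q = (β_ (Sym x) V).hom := by
    refine sym_hom_ind c ?_ ?_ hβ
    · rw [reassoc_of% hΦ0, BraidedCategory.braiding_naturality_left]
      simp [e, q]
    · rw [reassoc_of% hΦ1, hq, whiskerLeft_comp_assoc]
  have hβ' : c ≫ (β_ V (Sym x)).hom =
      x ◁ (β_ V (Sym x)).hom ≫ (α_ x (Sym x) V).inv ≫ symCons x ▷ V := by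
    have h := x ◁ (β_ V (Sym x)).hom ≫= (α_ x (Sym x) V).inv ≫= hβ =≫ (β_ V (Sym x)).hom
    simp only [Category.assoc, SymmetricCategory.symmetry, Category.comp_id,
      Iso.inv_hom_id_assoc] at h
    rw [h, ← whiskerLeft_comp_assoc, SymmetricCategory.symmetry]
    simp
  have hs : x ◁ (β_ V (Sym x)).hom ≫ x ◁ (β_ (Sym x) V).hom = 𝟙 _ := by
    rw [← whiskerLeft_comp, SymmetricCategory.symmetry, whiskerLeft_id]
  refine ⟨(β_ V (Sym x)).hom ≫ Φ ≫ p, ?_, ?_⟩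
  · rw [BraidedCategory.braiding_naturality_right_assoc, reassoc_of% hΦ0]
    simp [e, p]
  · rw [genAd_apply]
    congr 1
    rw [sub_eq_iff_eq_add, ← Category.assoc]
    change c ≫ _ = _
    rw [reassoc_of% hβ', reassoc_of% hΦ1, hp, Iso.inv_hom_id_assoc, Preadditive.comp_add,
      Preadditive.comp_add, ← whiskerLeft_comp_assoc x Φ q, hΦq, reassoc_of% hs, add_comm]
    simp

end Integration

/-! ### Restriction of differential operators to `S^{≤ k} x` -/

section Restriction

variable {C : Type u} [Category.{v} C] [Preadditive C] [MonoidalCategory C] [SymmetricCategory C]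
  [MonoidalPreadditive C] [TensorCocomplete C]

theorem lift_symGen (x : C) : lift (symGen x) = 𝟙 (Sym x) :=
  have : IsMonHom (𝟙 (Sym x)) := inferInstance
  (lift_unique (symGen x) (𝟙 _) (Category.comp_id _)).symm

theorem eq_of_mem_diff_sym {x V : C} {k : ℕ} {f g : V ⊗ Sym x ⟶ Sym x}
    (hf : f ∈ diff (swapAct V MonObj.mul) k) (hg : g ∈ diff (swapAct V MonObj.mul) k)
    (h : ∀ n < k, V ◁ toSym x n ≫ f = V ◁ toSym x n ≫ g) : f = g := by
  have : Epi (lift (symGen x)) := by rw [lift_symGen]; infer_instance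
  refine sub_eq_zero.1 (eq_zero_of_mem_diff (symGen x) (sub_mem hf hg) fun n hn => ?_)
  rw [← toSym_lift, lift_symGen, Category.comp_id, Preadditive.comp_sub, h n hn, sub_self]

theorem whiskerLeft_toSym_genAd {x V : C} (f : V ⊗ Sym x ⟶ Sym x) (n : ℕ) :
    (x ⊗ V) ◁ toSym x n ≫ genAd (symCons x) f = (α_ x V (tpow x n)).hom ≫
      (swapFirst x V (tpow x n) ≫ V ◁ toSym x (n + 1) ≫ f -
        x ◁ (V ◁ toSym x n ≫ f) ≫ symCons x) :=
  whiskerLeft_genAd _ _ _ _ (symCons_spec x n)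

theorem whiskerLeft_toSym_genAd_congr {x V : C} {k : ℕ} {f g : V ⊗ Sym x ⟶ Sym x}
    (h : ∀ n < k + 1, V ◁ toSym x n ≫ f = V ◁ toSym x n ≫ g) :
    ∀ n < k, (x ⊗ V) ◁ toSym x n ≫ genAd (symCons x) f =
      (x ⊗ V) ◁ toSym x n ≫ genAd (symCons x) g := by
  intro n hn
  rw [whiskerLeft_toSym_genAd, whiskerLeft_toSym_genAd, h n (by omega), h (n + 1) (by omega)]

theorem genAd_symCons_mem_diff {x V : C} {k : ℕ} {f : V ⊗ Sym x ⟶ Sym x}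
    (hf : f ∈ diff (swapAct V MonObj.mul) (k + 1)) :
    genAd (symCons x) f ∈ diff (swapAct (x ⊗ V) MonObj.mul) k := by
  rw [← symGen_mul]
  exact genAd_mem_diff (symGen x) hf

/-- On products of less than `k` generators, every map `g` agrees with a differential operator
of order less than `k`. The commutator with generators is given by
induction; it is integrable because its commutator is a differential operator agreeing with
the symmetric map `[[g, y], y']` where that determines it. -/
theorem exists_mem_diff {x V : C} (k : ℕ) (g : V ⊗ Sym x ⟶ Sym x) :
    ∃ Δ ∈ diff (swapAct V MonObj.mul) k,
      ∀ n < k, V ◁ toSym x n ≫ Δ = V ◁ toSym x n ≫ g := by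
  induction k generalizing V with
  | zero => exact ⟨0, zero_mem _, fun n hn => absurd hn (Nat.not_lt_zero n)⟩
  | succ k ih =>
    obtain ⟨δ, hδ, hg⟩ := ih (genAd (symCons x) g)
    have hs : swapFirst x x V ▷ Sym x ≫ genAd (symCons x) δ = genAd (symCons x) δ := by
      cases k with
      | zero => simp [mem_diff_zero.1 hδ]
      | succ k =>
        have h1 := genAd_symCons_mem_diff hδ
        have h2 := whiskerLeft_toSym_genAd_congr hg
        refine eq_of_mem_diff_sym (comp_mem_diff (IsActHom.whiskerRight _ _) h1) h1 fun n hn => ?_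
        rw [whisker_exchange_assoc, h2 n hn, ← whisker_exchange_assoc,
          swap_genAd_genAd (symCons_swap x)]
    obtain ⟨Δ, h0, hΔ⟩ := exists_genAd_eq δ hs (V ◁ symOne x ≫ g)
    refine ⟨Δ, mem_diff_succ_of_genAd (hΔ ▸ hδ), fun n hn => ?_⟩
    induction n with
    | zero => exact h0
    | succ n ihn =>
      have h := hg n (by omega)
      rw [← hΔ, whiskerLeft_toSym_genAd, whiskerLeft_toSym_genAd, ihn (by omega), cancel_epi,
        sub_left_inj, cancel_epi] at h
      exact h

/-- The inclusion `S^n x ⟶ S^{≤ k} x`. -/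
noncomputable def symLEι (x : C) (k : ℕ) (n : Fin (k + 1)) : symPow x n ⟶ symLE x k :=
  Sigma.ι (fun n : Fin (k + 1) => symPow x n) n

theorem symLEι_symLEIncl (x : C) (k : ℕ) (n : Fin (k + 1)) :
    symLEι x k n ≫ symLEIncl x k = symIncl x n :=
  Sigma.ι_desc _ _

theorem symLE_hom_ext {x V Y : C} {k : ℕ} {f g : V ⊗ Sym x ⟶ Y}
    (h : ∀ n < k + 1, V ◁ toSym x n ≫ f = V ◁ toSym x n ≫ g) :
    V ◁ symLEIncl x k ≫ f = V ◁ symLEIncl x k ≫ g := by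
  have : PreservesColimitsOfSize.{0, 0} (tensorLeft V) :=
    preservesSmallestColimits_of_preservesColimits _
  have hc := isColimitOfPreserves (tensorLeft V)
    (colimit.isColimit (Discrete.functor fun n : Fin (k + 1) => symPow x n))
  have key : ∀ n, V ◁ symLEι x k n ≫ V ◁ symLEIncl x k ≫ f =
      V ◁ symLEι x k n ≫ V ◁ symLEIncl x k ≫ g := by
    intro n
    have : Epi (symProj x n) := inferInstanceAs (Epi (wideCoequalizer.π (permMap x n)))
    have : Epi (V ◁ symProj x n) := inferInstanceAs (Epi ((tensorLeft V).map (symProj x n)))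
    have h := h n n.2
    rw [toSym, whiskerLeft_comp, Category.assoc, Category.assoc, cancel_epi] at h
    rw [← whiskerLeft_comp_assoc, ← whiskerLeft_comp_assoc, symLEι_symLEIncl, h]
  exact hc.hom_ext fun ⟨n⟩ => key n

instance (x : C) (k : ℕ) : IsSplitMono (symLEIncl x k) := by
  let r : Sym x ⟶ symLE x k :=
    Sigma.desc fun n => if h : n < k + 1 then symLEι x k ⟨n, h⟩ else 0
  have hr : ∀ n : Fin (k + 1), symIncl x n ≫ r = symLEι x k n := fun n =>
    (Sigma.ι_desc _ _).trans (dif_pos n.2)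
  refine ⟨⟨⟨r, Sigma.hom_ext _ _ fun n => ?_⟩⟩⟩
  change symLEι x k n ≫ symLEIncl x k ≫ r = symLEι x k n ≫ 𝟙 _
  rw [reassoc_of% symLEι_symLEIncl, hr, Category.comp_id]

/-- A differential operator of order at most `k` is determined by its restriction to
`S^{≤ k} x`. -/
theorem eq_of_symLE {x a : C} [MonObj a] [IsCommMonObj a] (c : x ⟶ a) [Epi (lift c)]
    {V : C} {k : ℕ} {f g : V ⊗ a ⟶ a} (hf : f ∈ diff (swapAct V MonObj.mul) (k + 1))
    (hg : g ∈ diff (swapAct V MonObj.mul) (k + 1))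
    (h : V ◁ (symLEIncl x k ≫ lift c) ≫ f = V ◁ (symLEIncl x k ≫ lift c) ≫ g) : f = g := by
  refine sub_eq_zero.1 (eq_zero_of_mem_diff c (sub_mem hf hg) fun n hn => ?_)
  have e : toSym x n = symProj x n ≫ symLEι x k ⟨n, hn⟩ ≫ symLEIncl x k := by
    rw [symLEι_symLEIncl, toSym]
  rw [← toSym_lift, e, Category.assoc, Category.assoc, whiskerLeft_comp_assoc,
    whiskerLeft_comp_assoc, Preadditive.comp_sub, sub_eq_zero.2 h, comp_zero, comp_zero]

/-- Every map on `S^{≤ k} x` extends to a differential operator on `Sx` of order at most `k`. -/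
theorem exists_extension_symLE {x V : C} {k : ℕ} (g : V ⊗ symLE x k ⟶ Sym x) :
    ∃ Δ ∈ diff (swapAct V MonObj.mul) (k + 1), V ◁ symLEIncl x k ≫ Δ = g := by
  obtain ⟨Δ, hΔ, h⟩ := exists_mem_diff (k + 1) (V ◁ retraction (symLEIncl x k) ≫ g)
  refine ⟨Δ, hΔ, (symLE_hom_ext h).trans ?_⟩
  rw [← whiskerLeft_comp_assoc, IsSplitMono.id]
  simp

/-- A differential operator without parameters is the same as one with the trivial parameter
object `𝟙_ C`. -/
theorem leftUnitor_comp_mem_diff {a : C} [MonObj a] {k : ℕ} {Δ : a ⟶ a} :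
    (λ_ a).hom ≫ Δ ∈ diff (swapAct (𝟙_ C) MonObj.mul) k ↔ Δ ∈ diff MonObj.mul k :=
  iso_comp_mem_diff (IsActHom.leftUnitor MonObj.mul)

theorem eq_of_symLE_even {x a : C} [MonObj a] [IsCommMonObj a] (c : x ⟶ a) [Epi (lift c)]
    {k : ℕ} {f g : a ⟶ a} (hf : f ∈ diff MonObj.mul (k + 1)) (hg : g ∈ diff MonObj.mul (k + 1))
    (h : (symLEIncl x k ≫ lift c) ≫ f = (symLEIncl x k ≫ lift c) ≫ g) : f = g := by
  rw [← cancel_epi (λ_ a).hom]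
  refine eq_of_symLE c (leftUnitor_comp_mem_diff.2 hf) (leftUnitor_comp_mem_diff.2 hg) ?_
  rw [leftUnitor_naturality_assoc, leftUnitor_naturality_assoc, h]

theorem exists_extension_symLE_even {x : C} {k : ℕ} (g : symLE x k ⟶ Sym x) :
    ∃ Δ ∈ diff MonObj.mul (k + 1), symLEIncl x k ≫ Δ = g := by
  obtain ⟨Δ, hΔ, h⟩ := exists_extension_symLE ((λ_ _).hom ≫ g)
  refine ⟨(λ_ _).inv ≫ Δ, leftUnitor_comp_mem_diff.1 (by rwa [Iso.hom_inv_id_assoc]), ?_⟩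
  rw [leftUnitor_inv_naturality_assoc, h, Iso.inv_hom_id_assoc]

end Restriction

end SymDiff

theorem mainTheorem5 {R : Type w} [CommRing R] {C : Type u} [Category.{v} C] [Preadditive C]
    [Linear R C] [MonoidalCategory C] [SymmetricCategory C] [MonoidalPreadditive C]
    [MonoidalLinear R C] [TensorCocomplete C] (k : ℕ) :
    -- the ungraded version
    ((∀ (x a : C) [MonObj a] [IsCommMonObj a] (f : x ⟶ a), Epi (SymDiff.lift f) →
        Function.Injective fun Δ : SymDiff.DiffOp R a k =>
          (SymDiff.symLEIncl x k ≫ SymDiff.lift f) ≫ Δ.1) ∧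
      (∀ x : C, ∃ e : SymDiff.DiffOp R (SymDiff.Sym x) k ≃ₗ[R]
          (SymDiff.symLE x k ⟶ SymDiff.Sym x),
        ∀ Δ, e Δ = SymDiff.symLEIncl x k ≫ Δ.1)) ∧
    -- the graded version
    ∀ P : SymDiff.ParityStructure C,
      (∀ (x a : C) [MonObj a] [IsCommMonObj a] (f : x ⟶ a), Epi (SymDiff.lift f) →
        (∀ z : C, Function.Injective (SymDiff.SHom.precomp R P (SymDiff.lift f) z)) ∧
        Function.Injective fun Δ : SymDiff.SDiffOp R P a k =>
          SymDiff.SHom.precomp R P (SymDiff.symLEIncl x k ≫ SymDiff.lift f) a Δ.1) ∧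
      (∀ x : C, ∃ e : SymDiff.SDiffOp R P (SymDiff.Sym x) k ≃ₗ[R]
          SymDiff.SHom P (SymDiff.symLE x k) (SymDiff.Sym x),
        (∀ Δ, e Δ = SymDiff.SHom.precomp R P (SymDiff.symLEIncl x k) (SymDiff.Sym x) Δ.1) ∧
        (∀ Δ, Δ.1 ∈ SymDiff.SHom.even R P (SymDiff.Sym x) (SymDiff.Sym x) ↔
          e Δ ∈ SymDiff.SHom.even R P (SymDiff.symLE x k) (SymDiff.Sym x)) ∧
        (∀ Δ, Δ.1 ∈ SymDiff.SHom.odd R P (SymDiff.Sym x) (SymDiff.Sym x) ↔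
          e Δ ∈ SymDiff.SHom.odd R P (SymDiff.symLE x k) (SymDiff.Sym x))) := by
  open SymDiff in
  have hS : ∀ x : C, Epi (lift (symGen x)) := fun x => by rw [lift_symGen]; infer_instance
  -- Uniqueness on `Sx` is the case of the canonical map `lift (symGen x) = 𝟙`.
  have ext_even : ∀ (x : C) {f g : Sym x ⟶ Sym x}, f ∈ diff MonObj.mul (k + 1) →
      g ∈ diff MonObj.mul (k + 1) → symLEIncl x k ≫ f = symLEIncl x k ≫ g → f = g :=
    fun x f g hf hg h => have := hS x
      eq_of_symLE_even (symGen x) hf hg (by rwa [lift_symGen, Category.comp_id])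
  have ext_param : ∀ (x V : C) {f g : V ⊗ Sym x ⟶ Sym x},
      f ∈ diff (swapAct V MonObj.mul) (k + 1) → g ∈ diff (swapAct V MonObj.mul) (k + 1) →
      V ◁ symLEIncl x k ≫ f = V ◁ symLEIncl x k ≫ g → f = g :=
    fun x V f g hf hg h => have := hS x
      eq_of_symLE (symGen x) hf hg (by rwa [lift_symGen, Category.comp_id])
  refine ⟨⟨?_, ?_⟩, fun P => ⟨?_, ?_⟩⟩
  · intro x a _ _ f _ Δ Δ' h
    exact Subtype.ext (eq_of_symLE_even f ((mem_DiffOp_iff R).1 Δ.2)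
      ((mem_DiffOp_iff R).1 Δ'.2) h)
  · intro x
    refine ⟨LinearEquiv.ofBijective
      ((Linear.leftComp R (Sym x) (symLEIncl x k)).domRestrict (DiffOp R (Sym x) k)) ⟨?_, ?_⟩,
      fun _ => rfl⟩
    · intro Δ Δ' h
      exact Subtype.ext (ext_even x ((mem_DiffOp_iff R).1 Δ.2) ((mem_DiffOp_iff R).1 Δ'.2) h)
    · intro g
      obtain ⟨Δ, hΔ, h⟩ := exists_extension_symLE_even g
      exact ⟨⟨Δ, (mem_DiffOp_iff R).2 hΔ⟩, h⟩
  · intro x a _ _ f _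
    refine ⟨fun z g g' h => ?_, fun Δ Δ' h => ?_⟩
    · have : Epi (P.π ◁ lift f) := inferInstanceAs (Epi ((tensorLeft P.π).map (lift f)))
      exact Prod.ext ((cancel_epi _).1 (congrArg Prod.fst h))
        ((cancel_epi _).1 (congrArg Prod.snd h))
    · have m := (mem_SDiffOp_iff R P).1 Δ.2
      have m' := (mem_SDiffOp_iff R P).1 Δ'.2
      exact Subtype.ext (Prod.ext (eq_of_symLE_even f m.1 m'.1 (congrArg Prod.fst h))
        (eq_of_symLE f m.2 m'.2 (congrArg Prod.snd h)))
  · intro x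
    have hb : Function.Bijective
        ((SHom.precomp R P (symLEIncl x k) (Sym x)).domRestrict (SDiffOp R P (Sym x) k)) := by
      constructor
      · intro Δ Δ' h
        have m := (mem_SDiffOp_iff R P).1 Δ.2
        have m' := (mem_SDiffOp_iff R P).1 Δ'.2
        exact Subtype.ext (Prod.ext (ext_even x m.1 m'.1 (congrArg Prod.fst h))
          (ext_param x _ m.2 m'.2 (congrArg Prod.snd h)))
      · intro g
        obtain ⟨Δ₀, m₀, e₀⟩ := exists_extension_symLE_even g.1
        obtain ⟨Δ₁, m₁, e₁⟩ := exists_extension_symLE g.2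
        exact ⟨⟨(Δ₀, Δ₁), (mem_SDiffOp_iff R P).2 ⟨m₀, m₁⟩⟩, Prod.ext e₀ e₁⟩
    refine ⟨LinearEquiv.ofBijective _ hb, fun _ => rfl, fun Δ => ?_, fun Δ => ?_⟩
    · have m := ((mem_SDiffOp_iff R P).1 Δ.2).2
      change Δ.1.2 = 0 ↔ P.π ◁ symLEIncl x k ≫ Δ.1.2 = 0
      exact ⟨fun h => by rw [h, comp_zero],
        fun h => ext_param x _ m (zero_mem _) (by rw [h, comp_zero])⟩
    · have m := ((mem_SDiffOp_iff R P).1 Δ.2).1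
      change Δ.1.1 = 0 ↔ symLEIncl x k ≫ Δ.1.1 = 0
      exact ⟨fun h => by rw [h, comp_zero],
        fun h => ext_even x m (zero_mem _) (by rw [h, comp_zero])⟩
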